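/- Let $\lambda,\mu>0$ and $d\ge 1/\lambda$. Consider the D/M/1/1 system: packets arrive at the times $\varphi+n/\lambda$, $n=0,1,2,\dots$, where the time $\varphi\ge 0$ of the first arrival is a constant or a random variable; a packet that finds the server idle is served at once, and a packet that finds it busy is discarded; the service times $X_0,X_1,\dots$ of the served packets are i.i.d. exponential with mean $1/\mu$ and independent of $\varphi$; the server is initially idle. Let $T_A(k)$ and $T_D(k)=T_A(k)+X_k$ be the arrival and departure times of the $k$-th served packet, $k\ge 0$, and let $$\Delta(t)=t-\max\{T_A(k): T_D(k)\le t\},\qquad t\ge 0,$$ be the age of information (before the first departure, $\Delta(t)=t+a_0$ with an initial age $a_0\ge 0$). For $k\ge 1$ let $g(k)$ be the length of time in $[T_D(k-1),T_D(k))$ during which $\Delta>d$, and let $\nu=1/\mathbb E[T_D(k)-T_D(k-1)]$ be the departure rate. Then, for every $k\ge 1$, $T_D(k)-T_D(k-1)$ and $g(k)$ are integrable, $\nu=\lambda(1-e^{-\mu/\lambda})$, and $$\mathbb E[g(k)]=\frac{e^{-\mu\lceil\lambda d\rceil/\lambda}}{\lambda(1-e^{-\mu/\lambda})}+e^{-\mu\lfloor\lambda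 d\rfloor/\lambda}\left[\frac{\lceil\lambda d\rceil}{\lambda}-d+\frac1\mu\right]+\frac{e^{-\mu d}}{\mu}\Big((e^{\mu/\lambda}-1)\lfloor\lambda d\rfloor-1\Big),$$ and the age violation probability is $\nu\,\mathbb E[g(k)]$, in the following sense: 1. almost surely, the fraction of time in $[0,T]$ during which $\Delta>d$ converges to $\nu\,\mathbb E[g(k)]$ as $T\to\infty$; 2. if the limit $\lim_{t\to\infty}\mathbb P(\Delta(t)>d)$ exists, it equals $\nu\,\mathbb E[g(k)]$; 3. if $\varphi$ is uniformly distributed on $[0,1/\lambda)$ (arrivals in steady state), this limit exists, so that $\lim_{t\to\infty}\mathbb P(\Delta(t)>d)=\nu\,\mathbb E[g(k)]$. -/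

import Mathlib

open MeasureTheory ProbabilityTheory Filter Topology

/- Sample paths of a single-server system without waiting room (GI/GI/1/1), arriving packets being
discarded while the server is busy. `τ n` is the time of the `n`-th arrival (`n = 0, 1, 2, …`) and
`x k` is the service time of the `k`-th served packet (`k = 0, 1, 2, …`). The server is initially
idle, so the first arriving packet is served. -/

/-- The index, among all arrivals, of the `k`-th served packet: after packet `k` has been taken into
service, the next packet served is the first later arrival that finds the server idle. -/
noncomputable def servedIndex (τ x : ℕ → ℝ) : ℕ → ℕ
  | 0 => 0
  | k + 1 => sInf {n : ℕ | servedIndex τ x k < n ∧ τ (servedIndex τ x k) + x k ≤ τ n}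

/-- `T_A(k)`: the arrival time of the `k`-th served packet. -/
noncomputable def arrivalTime (τ x : ℕ → ℝ) (k : ℕ) : ℝ := τ (servedIndex τ x k)

/-- `T_D(k)`: the departure time of the `k`-th served packet, whose service starts on arrival. -/
noncomputable def departureTime (τ x : ℕ → ℝ) (k : ℕ) : ℝ := arrivalTime τ x k + x k

/-- The age of information at time `t`: the time elapsed since the arrival (generation) of the
freshest packet that has departed by time `t`. The receiver starts with a status generated at
time `-a₀`, that is, with age `a₀` at time `0`. -/
noncomputable def ageOfInformation (τ x : ℕ → ℝ) (a₀ t : ℝ) : ℝ :=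
  t - sSup (insert (-a₀) {s : ℝ | ∃ k : ℕ, departureTime τ x k ≤ t ∧ s = arrivalTime τ x k})

/-- The time for which the age exceeds `d` between the consecutive age peaks at the departures of
the `k`-th and the `(k+1)`-st served packet. -/
noncomputable def violationDuration (τ x : ℕ → ℝ) (a₀ d : ℝ) (k : ℕ) : ℝ :=
  volume.real {t : ℝ | t ∈ Set.Ico (departureTime τ x k) (departureTime τ x (k + 1)) ∧
    d < ageOfInformation τ x a₀ t}

/-- Deterministic arrivals: one packet every `1 / lam` units of time, the first one at time `s`. -/
noncomputable def periodicArrivals (lam s : ℝ) (n : ℕ) : ℝ := s + n / lam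

/-- `ν = λ (1 - e^{-μ/λ})`. -/
noncomputable def nuDM11 (lam mu : ℝ) : ℝ := lam * (1 - Real.exp (-mu / lam))

/-- The closed form of the mean time for which the age exceeds `d` between consecutive peaks. -/
noncomputable def meanDurationDM11 (lam mu d : ℝ) : ℝ :=
  Real.exp (-mu * (⌈lam * d⌉ / lam)) / (lam * (1 - Real.exp (-mu / lam)))
    + Real.exp (-mu * (⌊lam * d⌋ / lam)) * (⌈lam * d⌉ / lam - d + 1 / mu)
    + Real.exp (-mu * d) / mu * ((Real.exp (mu / lam) - 1) * ⌊lam * d⌋ - 1)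

/-!
Let `M k = ⌈λ X k⌉`, the number of arrival periods between the starts of the `k`-th and the next
service. Both the time between two consecutive departures and the part of it during which the age
exceeds `d` are functions of the pair `(X k, X (k + 1))`. The strong law, applied separately to the
even and to the odd `k`, gives the averages of these over the first `n` cycles, and monotone
interpolation turns them into the long-run fraction of time with age above `d`: it is the ratio of
the two means, whatever the law of the services. By dominated convergence, the time averages of
`P(Δ(t) > d)` converge to the same constant, which is therefore the only possible limit.

The exponential law enters twice. Memorylessness makes the two means explicit. It also makes `M k`
geometric, so that each arrival after the first is served with one and the same probability `p`;
if the phase is uniform over a period, service starts then have the constant intensity `λ p`, and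
`P(Δ(t) ≤ d)` does not depend on `t` once `t` is large.
-/

theorem iUnion_Ico_succ_eq_Ici {α : Type*} [LinearOrder α] [NoMaxOrder α] {u : ℕ → α}
    (hmono : Monotone u) (hu : Tendsto u atTop atTop) :
    ⋃ k, Set.Ico (u k) (u (k + 1)) = Set.Ici (u 0) :=
  iUnion_Ico_map_succ_eq_Ici (fun k => hmono k.zero_le) (not_bddAbove_of_tendsto_atTop hu)

section SamplePath

variable {τ x : ℕ → ℝ} {a₀ d t : ℝ} {k : ℕ}

theorem servedIndex_succ_mem (hτ : Tendsto τ atTop atTop) (k : ℕ) :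
    servedIndex τ x (k + 1) ∈ {n | servedIndex τ x k < n ∧ departureTime τ x k ≤ τ n} :=
  Nat.sInf_mem ((eventually_gt_atTop _).and (hτ.eventually_ge_atTop _)).exists

theorem strictMono_servedIndex (hτ : Tendsto τ atTop atTop) : StrictMono (servedIndex τ x) :=
  strictMono_nat_of_lt_succ fun k => (servedIndex_succ_mem hτ k).1

theorem departureTime_le_arrivalTime_succ (hτ : Tendsto τ atTop atTop) (k : ℕ) :
    departureTime τ x k ≤ arrivalTime τ x (k + 1) :=
  (servedIndex_succ_mem hτ k).2

theorem arrivalTime_le_departureTime (hx : ∀ k, 0 ≤ x k) (k : ℕ) :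
    arrivalTime τ x k ≤ departureTime τ x k :=
  le_add_of_nonneg_right (hx k)

theorem monotone_arrivalTime (hτ : Tendsto τ atTop atTop) (hx : ∀ k, 0 ≤ x k) :
    Monotone (arrivalTime τ x) :=
  monotone_nat_of_le_succ fun k =>
    (arrivalTime_le_departureTime hx k).trans (departureTime_le_arrivalTime_succ hτ k)

theorem monotone_departureTime (hτ : Tendsto τ atTop atTop) (hx : ∀ k, 0 ≤ x k) :
    Monotone (departureTime τ x) :=
  monotone_nat_of_le_succ fun k =>
    (departureTime_le_arrivalTime_succ hτ k).trans (arrivalTime_le_departureTime hx (k + 1))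

theorem tendsto_departureTime (hτ : Tendsto τ atTop atTop) (hx : ∀ k, 0 ≤ x k) :
    Tendsto (departureTime τ x) atTop atTop :=
  tendsto_atTop_mono (arrivalTime_le_departureTime hx)
    (hτ.comp (strictMono_servedIndex hτ).tendsto_atTop)

theorem ageOfInformation_of_lt_departureTime_zero (hτ : Tendsto τ atTop atTop)
    (hx : ∀ k, 0 ≤ x k) (ht : t < departureTime τ x 0) : ageOfInformation τ x a₀ t = t + a₀ := by
  have hempty : {s | ∃ k, departureTime τ x k ≤ t ∧ s = arrivalTime τ x k} = ∅ :=
    Set.eq_empty_of_forall_notMem fun _ ⟨k, hk, _⟩ =>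
      (ht.trans_le (monotone_departureTime hτ hx k.zero_le)).not_ge hk
  rw [ageOfInformation, hempty, insert_empty_eq, csSup_singleton, sub_neg_eq_add]

theorem ageOfInformation_of_mem_Ico_departureTime (hτ : Tendsto τ atTop atTop)
    (hx : ∀ k, 0 ≤ x k) (ha : -a₀ ≤ τ 0)
    (ht : t ∈ Set.Ico (departureTime τ x k) (departureTime τ x (k + 1))) :
    ageOfInformation τ x a₀ t = t - arrivalTime τ x k := by
  have hgreatest : IsGreatest
      (insert (-a₀) {s | ∃ j, departureTime τ x j ≤ t ∧ s = arrivalTime τ x j})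
      (arrivalTime τ x k) := by
    refine ⟨Or.inr ⟨k, ht.1, rfl⟩, ?_⟩
    rintro _ (rfl | ⟨j, hj, rfl⟩)
    · exact ha.trans (monotone_arrivalTime hτ hx k.zero_le)
    · have hjk : j < k + 1 := (monotone_departureTime hτ hx).reflect_lt (hj.trans_lt ht.2)
      exact monotone_arrivalTime hτ hx (Nat.le_of_lt_succ hjk)
  rw [ageOfInformation, hgreatest.csSup_eq]

theorem ageOfInformation_le_iff (hτ : Tendsto τ atTop atTop) (hx : ∀ k, 0 ≤ x k)
    (ha : -a₀ ≤ τ 0) :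
    ageOfInformation τ x a₀ t ≤ d ↔
      (t < departureTime τ x 0 ∧ t + a₀ ≤ d) ∨
        ∃ k, t ∈ Set.Ico (departureTime τ x k) (departureTime τ x (k + 1)) ∧
          t - arrivalTime τ x k ≤ d := by
  constructor
  · intro h
    rcases lt_or_ge t (departureTime τ x 0) with ht | ht
    · exact Or.inl ⟨ht, ageOfInformation_of_lt_departureTime_zero hτ hx ht ▸ h⟩
    · obtain ⟨k, hk⟩ := Set.mem_iUnion.1 <| (iUnion_Ico_succ_eq_Ici
        (monotone_departureTime hτ hx) (tendsto_departureTime hτ hx)).ge ht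
      exact Or.inr ⟨k, hk, ageOfInformation_of_mem_Ico_departureTime hτ hx ha hk ▸ h⟩
  · rintro (⟨ht, h⟩ | ⟨k, hk, h⟩)
    · rwa [ageOfInformation_of_lt_departureTime_zero hτ hx ht]
    · rwa [ageOfInformation_of_mem_Ico_departureTime hτ hx ha hk]

theorem violationDuration_eq (hτ : Tendsto τ atTop atTop) (hx : ∀ k, 0 ≤ x k) (ha : -a₀ ≤ τ 0)
    (k : ℕ) :
    violationDuration τ x a₀ d k
      = max 0 (departureTime τ x (k + 1) - max (departureTime τ x k) (arrivalTime τ x k + d)) := by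
  have hset : {t : ℝ | t ∈ Set.Ico (departureTime τ x k) (departureTime τ x (k + 1)) ∧
        d < ageOfInformation τ x a₀ t}
      = Set.Ico (departureTime τ x k) (departureTime τ x (k + 1))
        ∩ Set.Ioi (arrivalTime τ x k + d) := by
    ext t
    refine and_congr_right fun ht => ?_
    rw [ageOfInformation_of_mem_Ico_departureTime hτ hx ha ht, lt_sub_iff_add_lt', Set.mem_Ioi]
  have hIoc : (Set.Ico (departureTime τ x k) (departureTime τ x (k + 1))
        ∩ Set.Ioi (arrivalTime τ x k + d) : Set ℝ)
      =ᵐ[volume] Set.Ioc (max (departureTime τ x k) (arrivalTime τ x k + d))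
        (departureTime τ x (k + 1)) := by
    rw [← Set.Ioc_inter_Ioi]
    exact Ico_ae_eq_Ioc.inter (ae_eq_refl _)
  rw [violationDuration, hset, measureReal_congr hIoc, Real.volume_real_Ioc, max_comm]

theorem measureReal_Icc_inter_eq_add {m : Measure ℝ} [NullSingletonClass m]
    [IsLocallyFiniteMeasure m] {a b c : ℝ} (hab : a ≤ b) (hbc : b ≤ c) (B : Set ℝ) :
    m.real (Set.Icc a c ∩ B) = m.real (Set.Icc a b ∩ B) + m.real (Set.Ico b c ∩ B) := by
  have hlow : Set.Icc a c ∩ B ∩ Set.Iio b = Set.Ico a b ∩ B := by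
    ext t
    simp only [Set.mem_inter_iff, Set.mem_Icc, Set.mem_Iio, Set.mem_Ico]
    exact ⟨fun h => ⟨⟨h.1.1.1, h.2⟩, h.1.2⟩, fun h => ⟨⟨⟨h.1.1, h.1.2.le.trans hbc⟩, h.2⟩, h.1.2⟩⟩
  have hupp : (Set.Icc a c ∩ B) \ Set.Iio b = Set.Icc b c ∩ B := by
    ext t
    simp only [Set.mem_sdiff, Set.mem_inter_iff, Set.mem_Icc, Set.mem_Iio, not_lt]
    exact ⟨fun h => ⟨⟨h.2, h.1.1.2⟩, h.1.2⟩, fun h => ⟨⟨⟨hab.trans h.1.1, h.1.2⟩, h.2⟩, h.1.1⟩⟩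
  rw [← measureReal_inter_add_sdiff (t := Set.Iio b) measurableSet_Iio
      (measure_ne_top_of_subset Set.inter_subset_left measure_Icc_lt_top.ne), hlow, hupp,
    measureReal_congr (Ico_ae_eq_Icc.inter (ae_eq_refl B)),
    measureReal_congr (Ico_ae_eq_Icc.inter (ae_eq_refl B))]

theorem measureReal_violation_departureTime (hτ : Tendsto τ atTop atTop) (hx : ∀ k, 0 ≤ x k)
    (h0 : 0 ≤ τ 0) (n : ℕ) :
    volume.real {t : ℝ | t ∈ Set.Icc 0 (departureTime τ x n) ∧ d < ageOfInformation τ x a₀ t}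
      = volume.real {t : ℝ | t ∈ Set.Icc 0 (departureTime τ x 0) ∧ d < ageOfInformation τ x a₀ t}
        + ∑ k ∈ Finset.range n, violationDuration τ x a₀ d k := by
  have hmono := monotone_departureTime hτ hx
  induction n with
  | zero => rw [Finset.sum_range_zero, add_zero]
  | succ n ih =>
    have hD : 0 ≤ departureTime τ x n :=
      (add_nonneg h0 (hx 0)).trans (hmono n.zero_le)
    rw [Finset.sum_range_succ, ← add_assoc, ← ih]
    exact measureReal_Icc_inter_eq_add hD (hmono n.le_succ) {t | d < ageOfInformation τ x a₀ t}

end SamplePath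

section Asymptotics

theorem tendsto_succ_div_natCast {u : ℕ → ℝ} {b : ℝ}
    (hu : Tendsto (fun n : ℕ => u n / n) atTop (𝓝 b)) :
    Tendsto (fun n : ℕ => u (n + 1) / n) atTop (𝓝 b) := by
  have hratio : Tendsto (fun n : ℕ => ((n : ℝ) / (n + 1))⁻¹) atTop (𝓝 1) := by
    simpa using (tendsto_natCast_div_add_atTop (1 : ℝ)).inv₀ one_ne_zero
  have hmul := (hu.comp (tendsto_add_atTop_nat 1)).mul hratio
  rw [mul_one] at hmul
  refine hmul.congr fun n => ?_
  have hn : ((n : ℝ) + 1) ≠ 0 := n.cast_add_one_ne_zero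
  simp only [Function.comp_apply, Nat.cast_add_one, inv_div]
  rw [div_mul_div_comm, mul_comm (u (n + 1)), mul_div_mul_left _ _ hn]

theorem tendsto_const_add_div_natCast {S : ℕ → ℝ} {c : ℝ} (a : ℝ)
    (hS : Tendsto (fun n : ℕ => S n / n) atTop (𝓝 c)) :
    Tendsto (fun n : ℕ => (a + S n) / n) atTop (𝓝 c) := by
  have ha : Tendsto (fun n : ℕ => a / n) atTop (𝓝 0) :=
    tendsto_const_nhds.div_atTop tendsto_natCast_atTop_atTop
  simpa only [add_div, zero_add] using ha.add hS

theorem tendsto_div_counting {V : ℝ → ℝ} {u : ℕ → ℝ} {k : ℝ → ℕ} {b : ℝ} (hV : Monotone V)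
    (hk : Tendsto k atTop atTop) (hku : ∀ᶠ T in atTop, T ∈ Set.Ico (u (k T)) (u (k T + 1)))
    (hVu : Tendsto (fun n : ℕ => V (u n) / n) atTop (𝓝 b)) :
    Tendsto (fun T => V T / k T) atTop (𝓝 b) := by
  refine tendsto_of_tendsto_of_tendsto_of_le_of_le' (hVu.comp hk)
    ((tendsto_succ_div_natCast hVu).comp hk) ?_ ?_
  · filter_upwards [hku] with T hT using
      div_le_div_of_nonneg_right (hV hT.1) (Nat.cast_nonneg _)
  · filter_upwards [hku] with T hT using
      div_le_div_of_nonneg_right (hV hT.2.le) (Nat.cast_nonneg _)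

theorem tendsto_div_atTop_of_monotone {V : ℝ → ℝ} {u : ℕ → ℝ} {b c : ℝ} (hV : Monotone V)
    (hu : Monotone u) (hc : 0 < c) (huc : Tendsto (fun n : ℕ => u n / n) atTop (𝓝 c))
    (hVu : Tendsto (fun n : ℕ => V (u n) / n) atTop (𝓝 b)) :
    Tendsto (fun T => V T / T) atTop (𝓝 (b / c)) := by
  have hutop : Tendsto u atTop atTop := by
    refine (huc.pos_mul_atTop hc tendsto_natCast_atTop_atTop).congr' ?_
    filter_upwards [eventually_ne_atTop 0] with n hn using
      div_mul_cancel₀ _ (Nat.cast_ne_zero.2 hn)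
  choose! k hk using fun T (hT : u 0 ≤ T) =>
    Set.mem_iUnion.1 ((iUnion_Ico_succ_eq_Ici hu hutop).ge hT)
  have hku : ∀ᶠ T in atTop, T ∈ Set.Ico (u (k T)) (u (k T + 1)) :=
    (eventually_ge_atTop (u 0)).mono hk
  have hktop : Tendsto k atTop atTop := by
    refine tendsto_atTop.2 fun N => ?_
    filter_upwards [hku, eventually_ge_atTop (u N)] with T hT hNT
    exact Nat.le_of_lt_succ (hu.reflect_lt (hNT.trans_lt hT.2))
  have hVk := tendsto_div_counting hV hktop hku hVu
  have hTk := tendsto_div_counting monotone_id hktop hku huc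
  refine (hVk.div hTk hc.ne').congr' ?_
  filter_upwards [hktop.eventually_ne_atTop 0] with T hT
  exact div_div_div_cancel_right₀ (Nat.cast_ne_zero.2 hT) _ _

theorem sum_range_eq_sum_even_add_sum_odd {M : Type*} [AddCommMonoid M] (f : ℕ → M) (n : ℕ) :
    ∑ k ∈ Finset.range n, f k
      = ∑ i ∈ Finset.range ((n + 1) / 2), f (2 * i)
        + ∑ i ∈ Finset.range (n / 2), f (2 * i + 1) := by
  induction n with
  | zero => simp
  | succ n ih =>
    rw [Finset.sum_range_succ, ih]
    obtain ⟨m, rfl | rfl⟩ := n.even_or_odd'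
    · rw [show (2 * m + 1) / 2 = m by omega, show (2 * m + 1 + 1) / 2 = m + 1 by omega,
        show 2 * m / 2 = m by omega, Finset.sum_range_succ, add_right_comm]
    · rw [show (2 * m + 1 + 1) / 2 = m + 1 by omega, show (2 * m + 1 + 1 + 1) / 2 = m + 1 by omega,
        show (2 * m + 1) / 2 = m by omega, Finset.sum_range_succ (fun i => f (2 * i + 1)),
        add_assoc]

theorem tendsto_natCast_half_div : Tendsto (fun n : ℕ => ((n / 2 : ℕ) : ℝ) / n) atTop (𝓝 2⁻¹) := by
  have hfloor := (tendsto_nat_floor_mul_div_atTop (R := ℝ) (a := 2⁻¹) (by norm_num)).comp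
    tendsto_natCast_atTop_atTop
  refine hfloor.congr fun n => ?_
  rw [Function.comp_apply, inv_mul_eq_div, Nat.floor_div_ofNat, Nat.floor_natCast]

theorem tendsto_average_of_even_odd {f : ℕ → ℝ} {c : ℝ}
    (heven : Tendsto (fun n : ℕ => (∑ i ∈ Finset.range n, f (2 * i)) / n) atTop (𝓝 c))
    (hodd : Tendsto (fun n : ℕ => (∑ i ∈ Finset.range n, f (2 * i + 1)) / n) atTop (𝓝 c)) :
    Tendsto (fun n : ℕ => (∑ k ∈ Finset.range n, f k) / n) atTop (𝓝 c) := by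
  have hhalf : Tendsto (fun n : ℕ => n / 2) atTop atTop :=
    Nat.tendsto_div_const_atTop two_ne_zero
  have hhalf' : Tendsto (fun n : ℕ => (((n + 1) / 2 : ℕ) : ℝ) / n) atTop (𝓝 2⁻¹) :=
    tendsto_succ_div_natCast (u := fun n => ((n / 2 : ℕ) : ℝ)) tendsto_natCast_half_div
  have hsum := ((heven.comp (hhalf.comp (tendsto_add_atTop_nat 1))).mul hhalf').add
    ((hodd.comp hhalf).mul tendsto_natCast_half_div)
  rw [← mul_add, show (2⁻¹ : ℝ) + 2⁻¹ = 1 by norm_num, mul_one] at hsum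
  refine hsum.congr' ?_
  filter_upwards [eventually_ge_atTop 2] with n hn
  have h1 : (((n + 1) / 2 : ℕ) : ℝ) ≠ 0 := Nat.cast_ne_zero.2 (by omega)
  have h2 : ((n / 2 : ℕ) : ℝ) ≠ 0 := Nat.cast_ne_zero.2 (by omega)
  simp only [Function.comp_apply]
  rw [div_mul_div_cancel₀ h1, div_mul_div_cancel₀ h2, ← add_div,
    ← sum_range_eq_sum_even_add_sum_odd]

end Asymptotics

section ConsecutivePairs

variable {Ω E : Type*} [MeasurableSpace Ω] [MeasurableSpace E] {P : Measure Ω}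
  [IsProbabilityMeasure P] {ρ : Measure E} {X : ℕ → Ω → E}

theorem map_prodMk_eq_prod {i j : ℕ} (hX : ∀ k, Measurable (X k)) (hlaw : ∀ k, P.map (X k) = ρ)
    (hindep : iIndepFun X P) (hij : i ≠ j) : P.map (fun ω => (X i ω, X j ω)) = ρ.prod ρ := by
  rw [(indepFun_iff_map_prod_eq_prod_map_map (hX i).aemeasurable (hX j).aemeasurable).1
    (hindep.indepFun hij), hlaw, hlaw]

theorem ae_tendsto_average_disjoint_pairs (hX : ∀ k, Measurable (X k))
    (hlaw : ∀ k, P.map (X k) = ρ) (hindep : iIndepFun X P) {F : E × E → ℝ} (hF : Measurable F)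
    (hint : Integrable F (ρ.prod ρ)) (r : ℕ) :
    ∀ᵐ ω ∂P, Tendsto
      (fun n : ℕ => (∑ i ∈ Finset.range n, F (X (2 * i + r) ω, X (2 * i + r + 1) ω)) / n)
      atTop (𝓝 (∫ z, F z ∂(ρ.prod ρ))) := by
  have hmeas (k : ℕ) : Measurable fun ω => (X k ω, X (k + 1) ω) := (hX k).prodMk (hX (k + 1))
  have hmap (k : ℕ) : P.map (fun ω => (X k ω, X (k + 1) ω)) = ρ.prod ρ :=
    map_prodMk_eq_prod hX hlaw hindep k.succ_ne_self.symm
  have hint0 : Integrable (fun ω => F (X (2 * 0 + r) ω, X (2 * 0 + r + 1) ω)) P :=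
    ((hmap _).symm ▸ hint).comp_measurable (hmeas _)
  have hlim := strong_law_ae_real (fun i ω => F (X (2 * i + r) ω, X (2 * i + r + 1) ω)) hint0
    (fun i j hij => (hindep.indepFun_prodMk_prodMk hX _ _ _ _ (by omega) (by omega) (by omega)
      (by omega)).comp hF hF)
    (fun i => IdentDistrib.comp ⟨(hmeas _).aemeasurable, (hmeas _).aemeasurable,
      (hmap _).trans (hmap _).symm⟩ hF)
  rwa [← integral_map (hmeas _).aemeasurable hF.aestronglyMeasurable, hmap] at hlim

/-- Consecutive pairs are not independent, but those with first index of a given parity are. -/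
theorem ae_tendsto_average_consecutive_pairs (hX : ∀ k, Measurable (X k))
    (hlaw : ∀ k, P.map (X k) = ρ) (hindep : iIndepFun X P) {F : E × E → ℝ} (hF : Measurable F)
    (hint : Integrable F (ρ.prod ρ)) :
    ∀ᵐ ω ∂P, Tendsto (fun n : ℕ => (∑ k ∈ Finset.range n, F (X k ω, X (k + 1) ω)) / n) atTop
      (𝓝 (∫ z, F z ∂(ρ.prod ρ))) := by
  filter_upwards [ae_tendsto_average_disjoint_pairs hX hlaw hindep hF hint 0,
    ae_tendsto_average_disjoint_pairs hX hlaw hindep hF hint 1] with ω heven hodd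
  exact tendsto_average_of_even_odd heven hodd

end ConsecutivePairs

/-- The number of arrival periods from the start of a service of length `x` to the start of the
next one. -/
noncomputable def occupiedSlots (lam x : ℝ) : ℕ := ⌈lam * x⌉₊

/-- The time between two consecutive departures, as a function of the two service times. -/
noncomputable def cycleLength (lam : ℝ) (z : ℝ × ℝ) : ℝ := occupiedSlots lam z.1 / lam + z.2 - z.1

/-- The time for which the age exceeds `d` between two consecutive departures, as a function of
the two service times. -/
noncomputable def cycleViolation (lam d : ℝ) (z : ℝ × ℝ) : ℝ :=
  max 0 (occupiedSlots lam z.1 / lam + z.2 - max z.1 d)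

section PeriodicArrivals

variable {lam s a₀ d : ℝ} {x : ℕ → ℝ}

theorem occupiedSlots_pos (hlam : 0 < lam) {y : ℝ} (hy : 0 < y) : 0 < occupiedSlots lam y :=
  Nat.ceil_pos.2 (mul_pos hlam hy)

theorem occupiedSlots_le_iff (hlam : 0 < lam) {y : ℝ} {m : ℕ} :
    occupiedSlots lam y ≤ m ↔ y ≤ m / lam := by
  rw [occupiedSlots, Nat.ceil_le, le_div_iff₀' hlam]

theorem tendsto_periodicArrivals (hlam : 0 < lam) (s : ℝ) :
    Tendsto (periodicArrivals lam s) atTop atTop :=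
  tendsto_atTop_add_const_left _ _ (tendsto_natCast_atTop_atTop.atTop_div_const hlam)

theorem periodicArrivals_zero (lam s : ℝ) : periodicArrivals lam s 0 = s := by
  rw [periodicArrivals, Nat.cast_zero, zero_div, add_zero]

theorem servedIndex_succ_periodicArrivals (hlam : 0 < lam) (hx : ∀ k, 0 < x k) (k : ℕ) :
    servedIndex (periodicArrivals lam s) x (k + 1)
      = servedIndex (periodicArrivals lam s) x k + occupiedSlots lam (x k) := by
  set N := servedIndex (periodicArrivals lam s) x k with hN
  have hset : {n : ℕ | N < n ∧ periodicArrivals lam s N + x k ≤ periodicArrivals lam s n}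
      = Set.Ici (N + occupiedSlots lam (x k)) := by
    ext n
    have hpos := occupiedSlots_pos hlam (hx k)
    rcases le_or_gt N n with hn | hn
    · obtain ⟨m, rfl⟩ := Nat.exists_eq_add_of_le hn
      have hm : periodicArrivals lam s N + x k ≤ periodicArrivals lam s (N + m) ↔
          occupiedSlots lam (x k) ≤ m := by
        rw [occupiedSlots_le_iff hlam, periodicArrivals, periodicArrivals, Nat.cast_add, add_div,
          ← add_assoc, add_le_add_iff_left]
      rw [Set.mem_ofPred_eq, hm, Set.mem_Ici]
      omega
    · simp only [Set.mem_ofPred_eq, Set.mem_Ici]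
      omega
  rw [servedIndex, ← hN, hset, csInf_Ici]

theorem servedIndex_periodicArrivals (hlam : 0 < lam) (hx : ∀ k, 0 < x k) (k : ℕ) :
    servedIndex (periodicArrivals lam s) x k = ∑ j ∈ Finset.range k, occupiedSlots lam (x j) := by
  induction k with
  | zero => rfl
  | succ k ih => rw [servedIndex_succ_periodicArrivals hlam hx, ih, Finset.sum_range_succ]

theorem departureTime_succ_periodicArrivals (hlam : 0 < lam) (hx : ∀ k, 0 < x k) (k : ℕ) :
    departureTime (periodicArrivals lam s) x (k + 1)
      = arrivalTime (periodicArrivals lam s) x k + occupiedSlots lam (x k) / lam + x (k + 1) := by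
  simp only [departureTime, arrivalTime, periodicArrivals,
    servedIndex_succ_periodicArrivals hlam hx]
  push_cast
  ring

theorem departureTime_succ_sub_periodicArrivals (hlam : 0 < lam) (hx : ∀ k, 0 < x k) (k : ℕ) :
    departureTime (periodicArrivals lam s) x (k + 1) - departureTime (periodicArrivals lam s) x k
      = cycleLength lam (x k, x (k + 1)) := by
  rw [departureTime_succ_periodicArrivals hlam hx, departureTime, cycleLength]
  ring

theorem violationDuration_periodicArrivals (hlam : 0 < lam) (hx : ∀ k, 0 < x k) (ha : -a₀ ≤ s)
    (k : ℕ) :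
    violationDuration (periodicArrivals lam s) x a₀ d k
      = cycleViolation lam d (x k, x (k + 1)) := by
  rw [violationDuration_eq (tendsto_periodicArrivals hlam s) (fun k => (hx k).le)
      (by rwa [periodicArrivals_zero]), departureTime_succ_periodicArrivals hlam hx, departureTime,
    max_add_add_left, cycleViolation]
  congr 1
  ring

@[fun_prop]
theorem measurable_occupiedSlots (lam : ℝ) : Measurable (occupiedSlots lam) :=
  Nat.measurable_ceil.comp (measurable_const_mul lam)

@[fun_prop]
theorem measurable_cycleLength (lam : ℝ) : Measurable (cycleLength lam) := by
  unfold cycleLength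
  fun_prop

@[fun_prop]
theorem measurable_cycleViolation (lam d : ℝ) : Measurable (cycleViolation lam d) := by
  unfold cycleViolation
  fun_prop

end PeriodicArrivals

section TimeAverage

variable {Ω : Type*} [MeasurableSpace Ω] {P : Measure Ω} [IsProbabilityMeasure P]

theorem volume_restrict_Icc_preimage_mul {T : ℝ} (hT : 0 < T) {S : Set ℝ} (hS : MeasurableSet S) :
    volume.restrict (Set.Icc 0 1) ((T * ·) ⁻¹' S)
      = ENNReal.ofReal (volume.real (Set.Icc 0 T ∩ S) / T) := by
  have hIcc : ((T * ·) ⁻¹' S) ∩ Set.Icc 0 1 = (T * ·) ⁻¹' (Set.Icc 0 T ∩ S) := by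
    rw [Set.preimage_inter, Set.preimage_const_mul_Icc₀ _ _ hT, zero_div, div_self hT.ne',
      Set.inter_comm]
  have hfin : volume (Set.Icc 0 T ∩ S) ≠ ⊤ :=
    measure_ne_top_of_subset Set.inter_subset_left measure_Icc_lt_top.ne
  rw [Measure.restrict_apply (measurable_const_mul T hS), hIcc,
    Real.volume_preimage_mul_left hT.ne', abs_of_pos (inv_pos.2 hT), div_eq_inv_mul,
    ENNReal.ofReal_mul (inv_pos.2 hT).le, ofReal_measureReal hfin]

theorem tendsto_lintegral_of_le_one_of_ae_tendsto_const {F : ℝ → Ω → ENNReal} {a : ENNReal}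
    (hF : ∀ T, Measurable (F T)) (hle : ∀ T ω, F T ω ≤ 1)
    (hlim : ∀ᵐ ω ∂P, Tendsto (fun T => F T ω) atTop (𝓝 a)) :
    Tendsto (fun T => ∫⁻ ω, F T ω ∂P) atTop (𝓝 a) := by
  have hdom := tendsto_lintegral_filter_of_dominated_convergence (fun _ => 1)
    (Eventually.of_forall hF) (Eventually.of_forall fun T => ae_of_all P (hle T)) (by simp) hlim
  rwa [lintegral_const, measure_univ, mul_one] at hdom

/-- The fraction of `[0, T]` spent in `B` is the probability that `(T * U, ω) ∈ B` for `U` uniform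
on `[0, 1]`; dominated convergence applies to it once for fixed `ω` and once for fixed `U`. -/
theorem eq_of_tendsto_measureReal_of_ae_tendsto_fraction {B : Set (ℝ × Ω)} (hB : MeasurableSet B)
    {c v : ℝ}
    (hfrac : ∀ᵐ ω ∂P, Tendsto
      (fun T => volume.real {t | t ∈ Set.Icc 0 T ∧ (t, ω) ∈ B} / T) atTop (𝓝 c))
    (hprob : Tendsto (fun t => P.real {ω | (t, ω) ∈ B}) atTop (𝓝 v)) : v = c := by
  set U : Measure ℝ := volume.restrict (Set.Icc 0 1) with hU
  have : IsProbabilityMeasure U := ⟨by simp [hU]⟩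
  have hBT (T : ℝ) : MeasurableSet {p : ℝ × Ω | (T * p.1, p.2) ∈ B} :=
    hB.preimage (by fun_prop)
  have hfubini (T : ℝ) : ∫⁻ u, P {ω | (T * u, ω) ∈ B} ∂U = ∫⁻ ω, U {u | (T * u, ω) ∈ B} ∂P :=
    (Measure.prod_apply (hBT T)).symm.trans (Measure.prod_apply_symm (hBT T))
  have htime : Tendsto (fun T => ∫⁻ ω, U {u | (T * u, ω) ∈ B} ∂P) atTop
      (𝓝 (ENNReal.ofReal c)) := by
    refine tendsto_lintegral_of_le_one_of_ae_tendsto_const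
      (fun T => measurable_measure_prodMk_right (hBT T)) (fun _ _ => prob_le_one) ?_
    filter_upwards [hfrac] with ω hω
    refine (ENNReal.tendsto_ofReal hω).congr' ?_
    filter_upwards [eventually_gt_atTop 0] with T hT
    exact (volume_restrict_Icc_preimage_mul hT (measurable_prodMk_right hB)).symm
  have hspace : Tendsto (fun T => ∫⁻ u, P {ω | (T * u, ω) ∈ B} ∂U) atTop
      (𝓝 (ENNReal.ofReal v)) := by
    refine tendsto_lintegral_of_le_one_of_ae_tendsto_const
      (fun T => measurable_measure_prodMk_left (hBT T)) (fun _ _ => prob_le_one) ?_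
    have hpos : ∀ᵐ u ∂U, 0 < u := by
      rw [hU, ← restrict_Ioc_eq_restrict_Icc]
      exact (ae_restrict_mem measurableSet_Ioc).mono fun u hu => hu.1
    filter_upwards [hpos] with u hu
    have hTu : Tendsto (fun T : ℝ => T * u) atTop atTop := tendsto_id.atTop_mul_const hu
    exact (ENNReal.tendsto_ofReal (hprob.comp hTu)).congr fun T => ofReal_measureReal
  have hvc := tendsto_nhds_unique hspace (htime.congr fun T => (hfubini T).symm)
  have hv : 0 ≤ v := ge_of_tendsto' hprob fun t => measureReal_nonneg
  obtain ⟨ω, hω⟩ := hfrac.exists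
  have hc : 0 ≤ c := ge_of_tendsto hω <| (eventually_ge_atTop 0).mono fun T hT =>
    div_nonneg measureReal_nonneg hT
  exact (ENNReal.ofReal_eq_ofReal_iff hv hc).1 hvc

end TimeAverage

section CycleMeans

variable {ρ : Measure ℝ} {lam : ℝ}

theorem integrable_occupiedSlots [IsFiniteMeasure ρ] (hρ : Integrable (fun y => y) ρ) (lam : ℝ) :
    Integrable (fun y => (occupiedSlots lam y : ℝ)) ρ := by
  refine ((hρ.const_mul lam).abs.add (integrable_const 1)).mono' (by fun_prop) ?_
  refine ae_of_all _ fun y => ?_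
  rw [Real.norm_natCast]
  exact (Nat.cast_le.2 (Nat.ceil_mono (le_abs_self _))).trans
    (Nat.ceil_lt_add_one (abs_nonneg _)).le

variable [IsProbabilityMeasure ρ]

theorem integrable_cycleLength (hρ : Integrable (fun y => y) ρ) (lam : ℝ) :
    Integrable (cycleLength lam) (ρ.prod ρ) :=
  ((((integrable_occupiedSlots hρ lam).div_const lam).comp_fst ρ).add (hρ.comp_snd ρ)).sub
    (hρ.comp_fst ρ)

theorem integrable_cycleViolation (hρ : Integrable (fun y => y) ρ) (lam d : ℝ) :
    Integrable (cycleViolation lam d) (ρ.prod ρ) :=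
  (integrable_const 0).sup <|
    ((((integrable_occupiedSlots hρ lam).div_const lam).comp_fst ρ).add (hρ.comp_snd ρ)).sub
      ((hρ.comp_fst ρ).sup (integrable_const d))

theorem integral_cycleLength (hρ : Integrable (fun y => y) ρ) (lam : ℝ) :
    ∫ z, cycleLength lam z ∂(ρ.prod ρ) = (∫ y, (occupiedSlots lam y : ℝ) ∂ρ) / lam := by
  have hslots := ((integrable_occupiedSlots hρ lam).div_const lam).comp_fst ρ
  have hfst := hρ.comp_fst ρ
  have hsnd := hρ.comp_snd ρ
  simp only [cycleLength]
  rw [integral_sub (by exact hslots.add hsnd) hfst, integral_add hslots hsnd,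
    integral_fun_fst (fun y => (occupiedSlots lam y : ℝ) / lam), integral_fun_fst (fun y => y),
    integral_fun_snd (fun y => y), add_sub_cancel_right, probReal_univ, one_smul,
    integral_div]

theorem integral_cycleLength_pos (hlam : 0 < lam) (hρ : Integrable (fun y => y) ρ)
    (hpos : ∀ᵐ y ∂ρ, 0 < y) : 0 < ∫ z, cycleLength lam z ∂(ρ.prod ρ) := by
  have hone : ∫ _, (1 : ℝ) ∂ρ ≤ ∫ y, (occupiedSlots lam y : ℝ) ∂ρ := by
    refine integral_mono_ae (integrable_const 1) (integrable_occupiedSlots hρ lam) ?_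
    filter_upwards [hpos] with y hy using Nat.one_le_cast.2 (occupiedSlots_pos hlam hy)
  rw [integral_const, probReal_univ, one_smul] at hone
  rw [integral_cycleLength hρ]
  positivity

end CycleMeans

/-- The D/GI/1/1 system: the service times `X k` are independent with common law `ρ`, almost surely
positive, and independent of the time `φ ≥ 0` of the first arrival. -/
structure IsDGI11 {Ω : Type*} [MeasurableSpace Ω] (P : Measure Ω) (ρ : Measure ℝ)
    (X : ℕ → Ω → ℝ) (φ : Ω → ℝ) : Prop where
  measurable_service : ∀ k, Measurable (X k)
  map_service : ∀ k, P.map (X k) = ρ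
  iIndepFun_service : iIndepFun X P
  ae_pos : ∀ᵐ y ∂ρ, 0 < y
  measurable_phase : Measurable φ
  phase_nonneg : ∀ᵐ ω ∂P, 0 ≤ φ ω
  indepFun_phase : IndepFun φ (fun ω k => X k ω) P

/-- The number of arrival periods from the first arrival to the start of the `k`-th service. -/
noncomputable def startSlot {Ω : Type*} (lam : ℝ) (X : ℕ → Ω → ℝ) (k : ℕ) (ω : Ω) : ℕ :=
  ∑ j ∈ Finset.range k, occupiedSlots lam (X j ω)

/-- The time at which the `k`-th service starts. -/
noncomputable def serviceStart {Ω : Type*} (lam : ℝ) (X : ℕ → Ω → ℝ) (φ : Ω → ℝ) (k : ℕ) (ω : Ω) :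
    ℝ :=
  φ ω + startSlot lam X k ω / lam

theorem measurableSet_age_le {Ω : Type*} [MeasurableSpace Ω] {A D : ℕ → Ω → ℝ}
    (hA : ∀ k, Measurable (A k)) (hD : ∀ k, Measurable (D k)) (a₀ d : ℝ) :
    MeasurableSet {p : ℝ × Ω | (p.1 < D 0 p.2 ∧ p.1 + a₀ ≤ d) ∨
      ∃ k, p.1 ∈ Set.Ico (D k p.2) (D (k + 1) p.2) ∧ p.1 - A k p.2 ≤ d} := by
  have hA' (k : ℕ) : Measurable fun p : ℝ × Ω => A k p.2 := (hA k).comp measurable_snd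
  have hD' (k : ℕ) : Measurable fun p : ℝ × Ω => D k p.2 := (hD k).comp measurable_snd
  rw [Set.ofPred_or, Set.ofPred_exists]
  refine ((measurableSet_lt measurable_fst (hD' 0)).inter
    (measurableSet_le (measurable_fst.add_const a₀) measurable_const)).union ?_
  exact MeasurableSet.iUnion fun k => ((measurableSet_le (hD' k) measurable_fst).inter
    (measurableSet_lt measurable_fst (hD' (k + 1)))).inter
    (measurableSet_le (measurable_fst.sub (hA' k)) measurable_const)

namespace IsDGI11

variable {Ω : Type*} [MeasurableSpace Ω] {P : Measure Ω} {ρ : Measure ℝ}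
  {X : ℕ → Ω → ℝ} {φ : Ω → ℝ} {lam d a₀ : ℝ}

theorem ae_service_pos (h : IsDGI11 P ρ X φ) : ∀ᵐ ω ∂P, ∀ k, 0 < X k ω :=
  ae_all_iff.2 fun k => ae_of_ae_map (h.measurable_service k).aemeasurable
    ((h.map_service k).symm ▸ h.ae_pos)

theorem ae_departureTime_succ_sub (h : IsDGI11 P ρ X φ) (hlam : 0 < lam) (k : ℕ) :
    (fun ω => departureTime (periodicArrivals lam (φ ω)) (fun j => X j ω) (k + 1)
      - departureTime (periodicArrivals lam (φ ω)) (fun j => X j ω) k)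
      =ᵐ[P] fun ω => cycleLength lam (X k ω, X (k + 1) ω) := by
  filter_upwards [h.ae_service_pos] with ω hpos using
    departureTime_succ_sub_periodicArrivals hlam hpos k

theorem ae_violationDuration (h : IsDGI11 P ρ X φ) (hlam : 0 < lam) (ha₀ : 0 ≤ a₀) (k : ℕ) :
    (fun ω => violationDuration (periodicArrivals lam (φ ω)) (fun j => X j ω) a₀ d k)
      =ᵐ[P] fun ω => cycleViolation lam d (X k ω, X (k + 1) ω) := by
  filter_upwards [h.ae_service_pos, h.phase_nonneg] with ω hpos hφ using
    violationDuration_periodicArrivals hlam hpos ((neg_nonpos.2 ha₀).trans hφ) k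

theorem measurable_pair (h : IsDGI11 P ρ X φ) (k : ℕ) :
    Measurable fun ω => (X k ω, X (k + 1) ω) :=
  (h.measurable_service k).prodMk (h.measurable_service (k + 1))

theorem measurable_startSlot (h : IsDGI11 P ρ X φ) (lam : ℝ) (k : ℕ) :
    Measurable (startSlot lam X k) :=
  Finset.measurable_fun_sum _ fun j _ =>
    (measurable_occupiedSlots lam).comp (h.measurable_service j)

theorem measurable_serviceStart (h : IsDGI11 P ρ X φ) (lam : ℝ) (k : ℕ) :
    Measurable (serviceStart lam X φ k) :=
  h.measurable_phase.add ((measurable_from_nat.comp (h.measurable_startSlot lam k)).div_const lam)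

theorem ae_arrivalTime_eq (h : IsDGI11 P ρ X φ) (hlam : 0 < lam) :
    ∀ᵐ ω ∂P, ∀ k, arrivalTime (periodicArrivals lam (φ ω)) (fun j => X j ω) k
      = serviceStart lam X φ k ω := by
  filter_upwards [h.ae_service_pos] with ω hpos k
  rw [arrivalTime, servedIndex_periodicArrivals hlam hpos, periodicArrivals,
    serviceStart, startSlot]

theorem exists_measurableSet_violation (h : IsDGI11 P ρ X φ) (hlam : 0 < lam) (ha₀ : 0 ≤ a₀)
    (d : ℝ) :
    ∃ B : Set (ℝ × Ω), MeasurableSet B ∧ ∀ᵐ ω ∂P, ∀ t,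
      d < ageOfInformation (periodicArrivals lam (φ ω)) (fun j => X j ω) a₀ t ↔ (t, ω) ∈ B := by
  refine ⟨_, (measurableSet_age_le (h.measurable_serviceStart lam)
    (fun k => (h.measurable_serviceStart lam k).add (h.measurable_service k)) a₀ d).compl, ?_⟩
  filter_upwards [h.ae_service_pos, h.phase_nonneg, h.ae_arrivalTime_eq hlam] with ω hpos hφ harr t
  rw [← not_le, ageOfInformation_le_iff (tendsto_periodicArrivals hlam _) (fun k => (hpos k).le)
    (by rw [periodicArrivals_zero]; exact (neg_nonpos.2 ha₀).trans hφ)]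
  simp only [departureTime, harr, Set.mem_compl_iff, Set.mem_ofPred_eq, Pi.add_apply]

theorem nullMeasurableSet_violation (h : IsDGI11 P ρ X φ) (hlam : 0 < lam) (ha₀ : 0 ≤ a₀)
    (d t : ℝ) : NullMeasurableSet {ω |
      d < ageOfInformation (periodicArrivals lam (φ ω)) (fun j => X j ω) a₀ t} P := by
  obtain ⟨B, hB, hBiff⟩ := h.exists_measurableSet_violation hlam ha₀ d
  exact (measurable_prodMk_left hB).nullMeasurableSet.congr
    (hBiff.mono fun ω hω => propext (hω t).symm)

variable [IsProbabilityMeasure P]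

theorem isProbabilityMeasure (h : IsDGI11 P ρ X φ) : IsProbabilityMeasure ρ :=
  h.map_service 0 ▸ Measure.isProbabilityMeasure_map (h.measurable_service 0).aemeasurable

theorem map_pair (h : IsDGI11 P ρ X φ) (k : ℕ) :
    P.map (fun ω => (X k ω, X (k + 1) ω)) = ρ.prod ρ :=
  map_prodMk_eq_prod h.measurable_service h.map_service h.iIndepFun_service k.succ_ne_self.symm

theorem integrable_comp_pair (h : IsDGI11 P ρ X φ) {F : ℝ × ℝ → ℝ} (hF : Integrable F (ρ.prod ρ))
    (k : ℕ) : Integrable (fun ω => F (X k ω, X (k + 1) ω)) P :=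
  ((h.map_pair k).symm ▸ hF).comp_measurable (h.measurable_pair k)

theorem integral_comp_pair (h : IsDGI11 P ρ X φ) {F : ℝ × ℝ → ℝ} (hF : Measurable F) (k : ℕ) :
    ∫ ω, F (X k ω, X (k + 1) ω) ∂P = ∫ z, F z ∂(ρ.prod ρ) := by
  rw [← h.map_pair k, integral_map (h.measurable_pair k).aemeasurable hF.aestronglyMeasurable]

theorem integrable_departureTime_succ_sub (h : IsDGI11 P ρ X φ) (hρ : Integrable (fun y => y) ρ)
    (hlam : 0 < lam) (k : ℕ) :
    Integrable (fun ω => departureTime (periodicArrivals lam (φ ω)) (fun j => X j ω) (k + 1)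
      - departureTime (periodicArrivals lam (φ ω)) (fun j => X j ω) k) P := by
  have := h.isProbabilityMeasure
  exact (h.integrable_comp_pair (integrable_cycleLength hρ lam) k).congr
    (h.ae_departureTime_succ_sub hlam k).symm

theorem integral_departureTime_succ_sub (h : IsDGI11 P ρ X φ) (hlam : 0 < lam) (k : ℕ) :
    ∫ ω, (departureTime (periodicArrivals lam (φ ω)) (fun j => X j ω) (k + 1)
      - departureTime (periodicArrivals lam (φ ω)) (fun j => X j ω) k) ∂P
      = ∫ z, cycleLength lam z ∂(ρ.prod ρ) := by
  rw [integral_congr_ae (h.ae_departureTime_succ_sub hlam k),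
    h.integral_comp_pair (measurable_cycleLength lam) k]

theorem integrable_violationDuration (h : IsDGI11 P ρ X φ) (hρ : Integrable (fun y => y) ρ)
    (hlam : 0 < lam) (ha₀ : 0 ≤ a₀) (d : ℝ) (k : ℕ) : Integrable (fun ω =>
      violationDuration (periodicArrivals lam (φ ω)) (fun j => X j ω) a₀ d k) P := by
  have := h.isProbabilityMeasure
  exact (h.integrable_comp_pair (integrable_cycleViolation hρ lam d) k).congr
    (h.ae_violationDuration hlam ha₀ k).symm

theorem integral_violationDuration (h : IsDGI11 P ρ X φ) (hlam : 0 < lam) (ha₀ : 0 ≤ a₀) (d : ℝ)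
    (k : ℕ) :
    ∫ ω, violationDuration (periodicArrivals lam (φ ω)) (fun j => X j ω) a₀ d k ∂P
      = ∫ z, cycleViolation lam d z ∂(ρ.prod ρ) := by
  rw [integral_congr_ae (h.ae_violationDuration hlam ha₀ k),
    h.integral_comp_pair (measurable_cycleViolation lam d) k]

theorem ae_tendsto_violation_fraction (h : IsDGI11 P ρ X φ) (hρ : Integrable (fun y => y) ρ)
    (hlam : 0 < lam) (ha₀ : 0 ≤ a₀) (d : ℝ) :
    ∀ᵐ ω ∂P, Tendsto (fun T : ℝ => volume.real {t : ℝ | t ∈ Set.Icc 0 T ∧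
        d < ageOfInformation (periodicArrivals lam (φ ω)) (fun j => X j ω) a₀ t} / T) atTop
      (𝓝 ((∫ z, cycleViolation lam d z ∂(ρ.prod ρ)) / ∫ z, cycleLength lam z ∂(ρ.prod ρ))) := by
  have := h.isProbabilityMeasure
  filter_upwards [h.ae_service_pos, h.phase_nonneg,
    ae_tendsto_average_consecutive_pairs h.measurable_service h.map_service h.iIndepFun_service
      (measurable_cycleLength lam) (integrable_cycleLength hρ lam),
    ae_tendsto_average_consecutive_pairs h.measurable_service h.map_service h.iIndepFun_service
      (measurable_cycleViolation lam d) (integrable_cycleViolation hρ lam d)]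
    with ω hpos hφ hlength hviolation
  set τ := periodicArrivals lam (φ ω)
  set x : ℕ → ℝ := fun j => X j ω
  have hτ : Tendsto τ atTop atTop := tendsto_periodicArrivals hlam _
  have hx : ∀ k, 0 ≤ x k := fun k => (hpos k).le
  have hτ0 : 0 ≤ τ 0 := hφ.trans_eq (periodicArrivals_zero lam _).symm
  have hmono : Monotone fun T : ℝ =>
      volume.real {t : ℝ | t ∈ Set.Icc 0 T ∧ d < ageOfInformation τ x a₀ t} := fun T T' hT =>
    measureReal_mono (fun t ht => ⟨⟨ht.1.1, ht.1.2.trans hT⟩, ht.2⟩)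
      (measure_ne_top_of_subset (fun t ht => ht.1) measure_Icc_lt_top.ne)
  refine tendsto_div_atTop_of_monotone hmono (monotone_departureTime hτ hx)
    (integral_cycleLength_pos hlam hρ h.ae_pos) ?_ ?_
  · refine (tendsto_const_add_div_natCast (departureTime τ x 0) hlength).congr fun n => ?_
    rw [← Finset.sum_congr rfl fun k _ => departureTime_succ_sub_periodicArrivals hlam hpos k,
      Finset.sum_range_sub, add_sub_cancel]
  · refine (tendsto_const_add_div_natCast (volume.real {t : ℝ |
      t ∈ Set.Icc 0 (departureTime τ x 0) ∧ d < ageOfInformation τ x a₀ t}) hviolation).congr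
      fun n => ?_
    rw [measureReal_violation_departureTime hτ hx hτ0 n,
      Finset.sum_congr rfl fun k _ => violationDuration_periodicArrivals hlam hpos
        ((neg_nonpos.2 ha₀).trans hφ) k]

theorem eq_of_tendsto_violation (h : IsDGI11 P ρ X φ) (hρ : Integrable (fun y => y) ρ)
    (hlam : 0 < lam) (ha₀ : 0 ≤ a₀) {v : ℝ}
    (hv : Tendsto (fun t => P.real {ω |
      d < ageOfInformation (periodicArrivals lam (φ ω)) (fun j => X j ω) a₀ t}) atTop (𝓝 v)) :
    v = (∫ z, cycleViolation lam d z ∂(ρ.prod ρ)) / ∫ z, cycleLength lam z ∂(ρ.prod ρ) := by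
  obtain ⟨B, hB, hBiff⟩ := h.exists_measurableSet_violation hlam ha₀ d
  refine eq_of_tendsto_measureReal_of_ae_tendsto_fraction hB (P := P) ?_ (hv.congr fun t => ?_)
  · filter_upwards [hBiff, h.ae_tendsto_violation_fraction hρ hlam ha₀ d] with ω hω hfrac
    simpa only [hω] using hfrac
  · exact measureReal_congr (hBiff.mono fun ω hω => propext (hω t))

end IsDGI11

section Exponential

variable {r a b : ℝ}

theorem expMeasure_apply (r : ℝ) {s : Set ℝ} (hs : MeasurableSet s) :
    expMeasure r s = ∫⁻ y, s.indicator (exponentialPDF r) y := by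
  rw [expMeasure, gammaMeasure, withDensity_apply _ hs, lintegral_indicator hs]
  rfl

theorem expMeasure_restrict_Ioi (r : ℝ) (ha : 0 ≤ a) :
    (expMeasure r).restrict (Set.Ioi a)
      = ENNReal.ofReal (Real.exp (-(r * a))) • (expMeasure r).map (· + a) := by
  ext s hs
  have hadd : Measurable (· + a) := measurable_add_const a
  rw [Measure.restrict_apply hs, Measure.smul_apply, Measure.map_apply hadd hs,
    expMeasure_apply r (hs.inter measurableSet_Ioi), expMeasure_apply r (hadd hs), smul_eq_mul,
    ← lintegral_const_mul' _ _ ENNReal.ofReal_ne_top, ← lintegral_add_right_eq_self _ a]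
  refine lintegral_congr_ae ?_
  filter_upwards [Measure.ae_ne volume (0 : ℝ)] with y hy
  by_cases hys : y + a ∈ s
  · rcases lt_or_gt_of_ne hy with hneg | hpos
    · rw [Set.indicator_of_notMem, Set.indicator_of_mem (by exact hys),
        exponentialPDF_of_neg hneg, mul_zero]
      simp [hneg.le]
    · rw [Set.indicator_of_mem (show y + a ∈ s ∩ Set.Ioi a from ⟨hys, by simpa using hpos⟩),
        Set.indicator_of_mem (by exact hys), exponentialPDF_of_nonneg hpos.le,
        exponentialPDF_of_nonneg (by positivity), ← ENNReal.ofReal_mul (Real.exp_pos _).le,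
        mul_add, neg_add, Real.exp_add]
      ring_nf
  · rw [Set.indicator_of_notMem fun h => hys h.1, Set.indicator_of_notMem (by exact hys), mul_zero]

theorem setIntegral_Ioi_expMeasure (r : ℝ) (ha : 0 ≤ a) (f : ℝ → ℝ) :
    ∫ y in Set.Ioi a, f y ∂(expMeasure r)
      = Real.exp (-(r * a)) * ∫ y, f (y + a) ∂(expMeasure r) := by
  rw [expMeasure_restrict_Ioi r ha, integral_smul_measure,
    (measurableEmbedding_addRight a).integral_map, ENNReal.toReal_ofReal (Real.exp_pos _).le,
    smul_eq_mul]

theorem expMeasure_Ioi (hr : 0 < r) (ha : 0 ≤ a) :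
    expMeasure r (Set.Ioi a) = ENNReal.ofReal (Real.exp (-(r * a))) := by
  have := isProbabilityMeasure_expMeasure hr
  rw [← Measure.restrict_apply_univ, expMeasure_restrict_Ioi r ha, Measure.smul_apply,
    Measure.map_apply (measurable_add_const a) .univ, Set.preimage_univ, measure_univ,
    smul_eq_mul, mul_one]

theorem ae_pos_expMeasure (hr : 0 < r) : ∀ᵐ y ∂(expMeasure r), 0 < y := by
  have := isProbabilityMeasure_expMeasure hr
  have h : expMeasure r (Set.Ioi 0) = 1 := by simp [expMeasure_Ioi hr le_rfl]
  exact (prob_compl_eq_zero_iff measurableSet_Ioi).2 h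

theorem setIntegral_Ioi_zero_expMeasure (hr : 0 < r) (f : ℝ → ℝ) :
    ∫ y in Set.Ioi 0, f y ∂(expMeasure r) = ∫ y, f y ∂(expMeasure r) := by
  have h : (expMeasure r).restrict (Set.Ioi 0) = expMeasure r :=
    Measure.restrict_eq_self_of_ae_mem (ae_pos_expMeasure hr)
  rw [h]

theorem measureReal_expMeasure_Ioi (hr : 0 < r) (ha : 0 ≤ a) :
    (expMeasure r).real (Set.Ioi a) = Real.exp (-(r * a)) := by
  rw [measureReal_def, expMeasure_Ioi hr ha, ENNReal.toReal_ofReal (Real.exp_pos _).le]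

theorem measureReal_expMeasure_Ioc (hr : 0 < r) (ha : 0 ≤ a) (hab : a ≤ b) :
    (expMeasure r).real (Set.Ioc a b) = Real.exp (-(r * a)) - Real.exp (-(r * b)) := by
  have := isProbabilityMeasure_expMeasure hr
  rw [← measureReal_expMeasure_Ioi hr ha, ← measureReal_expMeasure_Ioi hr (ha.trans hab),
    ← Set.Ioc_union_Ioi_eq_Ioi hab,
    measureReal_union (Set.Ioc_disjoint_Ioi le_rfl) measurableSet_Ioi, add_sub_cancel_right]

theorem setIntegral_Ioc_expMeasure_of_eqOn_const {f : ℝ → ℝ} {c : ℝ} (hr : 0 < r) (ha : 0 ≤ a)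
    (hab : a ≤ b) (hf : Set.EqOn f (fun _ => c) (Set.Ioc a b)) :
    ∫ y in Set.Ioc a b, f y ∂(expMeasure r)
      = (Real.exp (-(r * a)) - Real.exp (-(r * b))) * c := by
  rw [setIntegral_congr_fun measurableSet_Ioc hf, setIntegral_const,
    measureReal_expMeasure_Ioc hr ha hab, smul_eq_mul]

theorem lintegral_id_expMeasure (hr : 0 < r) :
    ∫⁻ y, ENNReal.ofReal y ∂(expMeasure r) = ENNReal.ofReal (1 / r) := by
  rw [lintegral_eq_lintegral_meas_lt _ ((ae_pos_expMeasure hr).mono fun _ h => h.le)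
      measurable_id'.aemeasurable,
    setLIntegral_congr_fun (g := fun t => ENNReal.ofReal (Real.exp (-r * t))) measurableSet_Ioi
      fun t ht => ?tail,
    ← ofReal_integral_eq_lintegral_ofReal (exp_neg_integrableOn_Ioi 0 hr)
      (Eventually.of_forall fun _ => (Real.exp_pos _).le),
    integral_exp_mul_Ioi (neg_neg_of_pos hr) 0]
  case tail => exact (expMeasure_Ioi hr (le_of_lt ht)).trans (by simp only [neg_mul])
  simp

theorem integrable_id_expMeasure (hr : 0 < r) : Integrable (fun y => y) (expMeasure r) := by
  refine ⟨measurable_id.aestronglyMeasurable, ?_⟩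
  rw [hasFiniteIntegral_iff_ofReal ((ae_pos_expMeasure hr).mono fun _ h => h.le),
    lintegral_id_expMeasure hr]
  exact ENNReal.ofReal_lt_top

theorem integral_id_expMeasure (hr : 0 < r) : ∫ y, y ∂(expMeasure r) = 1 / r := by
  rw [integral_eq_lintegral_of_nonneg_ae ((ae_pos_expMeasure hr).mono fun _ h => h.le)
    measurable_id.aestronglyMeasurable, lintegral_id_expMeasure hr,
    ENNReal.toReal_ofReal (by positivity)]

theorem integral_max_sub_expMeasure_of_nonneg (hr : 0 < r) (ha : 0 ≤ a) :
    ∫ y, max 0 (y - a) ∂(expMeasure r) = Real.exp (-(r * a)) / r := by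
  have h : (fun y => max 0 (y - a)) = (Set.Ioi a).indicator (fun y => y - a) := by
    ext y
    by_cases hy : a < y
    · rw [Set.indicator_of_mem (by exact hy), max_eq_right (by linarith)]
    · rw [Set.indicator_of_notMem (by exact hy), max_eq_left (by linarith)]
  rw [h, integral_indicator measurableSet_Ioi, setIntegral_Ioi_expMeasure r ha]
  simp only [add_sub_cancel_right, integral_id_expMeasure hr, mul_one_div]

theorem integral_max_sub_expMeasure_of_nonpos (hr : 0 < r) (ha : a ≤ 0) :
    ∫ y, max 0 (y - a) ∂(expMeasure r) = 1 / r - a := by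
  have := isProbabilityMeasure_expMeasure hr
  have h : (fun y => max 0 (y - a)) =ᵐ[expMeasure r] fun y => y - a := by
    filter_upwards [ae_pos_expMeasure hr] with y hy using max_eq_right (by linarith)
  rw [integral_congr_ae h, integral_sub (integrable_id_expMeasure hr) (integrable_const _),
    integral_id_expMeasure hr, integral_const, probReal_univ, one_smul]

end Exponential

section ExponentialMeans

variable {lam mu d x y : ℝ}

theorem setIntegral_Ioi_eq_Ioc_add_Ioi {ρ : Measure ℝ} {f : ℝ → ℝ} (hf : Integrable f ρ) {a b : ℝ}
    (hab : a ≤ b) :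
    ∫ y in Set.Ioi a, f y ∂ρ = ∫ y in Set.Ioc a b, f y ∂ρ + ∫ y in Set.Ioi b, f y ∂ρ := by
  rw [← Set.Ioc_union_Ioi_eq_Ioi hab, setIntegral_union (Set.Ioc_disjoint_Ioi le_rfl)
    measurableSet_Ioi hf.integrableOn hf.integrableOn]

theorem le_occupiedSlots_div (hlam : 0 < lam) (y : ℝ) : y ≤ occupiedSlots lam y / lam :=
  (occupiedSlots_le_iff hlam).1 le_rfl

theorem occupiedSlots_add_div (hlam : 0 < lam) (hy : 0 ≤ y) (n : ℕ) :
    occupiedSlots lam (y + n / lam) = occupiedSlots lam y + n := by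
  rw [occupiedSlots, occupiedSlots, mul_add, mul_div_cancel₀ _ hlam.ne',
    Nat.ceil_add_natCast (by positivity)]

theorem occupiedSlots_eq_succ_iff (hlam : 0 < lam) {n : ℕ} :
    occupiedSlots lam y = n + 1 ↔ y ∈ Set.Ioc ((n : ℝ) / lam) ((n + 1 : ℕ) / lam) := by
  rw [Set.mem_Ioc, ← not_le, ← occupiedSlots_le_iff hlam, ← occupiedSlots_le_iff hlam]
  omega

theorem occupiedSlots_eq_of_floor_lt (hlam : 0 < lam) (hfloor : ⌊lam * d⌋₊ / lam < y)
    (hceil : y ≤ ⌈lam * d⌉₊ / lam) : occupiedSlots lam y = ⌈lam * d⌉₊ := by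
  rw [← occupiedSlots_le_iff hlam] at hceil
  rw [← not_le, ← occupiedSlots_le_iff hlam] at hfloor
  have := Nat.ceil_le_floor_add_one (lam * d)
  omega

theorem floor_div_le (hlam : 0 < lam) (hd : 0 ≤ d) : (⌊lam * d⌋₊ : ℝ) / lam ≤ d :=
  (div_le_iff₀' hlam).2 (Nat.floor_le (by positivity))

theorem one_sub_exp_pos (hlam : 0 < lam) (hmu : 0 < mu) : 0 < 1 - Real.exp (-(mu / lam)) :=
  sub_pos.2 (Real.exp_lt_one_iff.2 (neg_neg_of_pos (div_pos hmu hlam)))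

theorem setIntegral_Ioi_occupiedSlots (hlam : 0 < lam) (hmu : 0 < mu) (n : ℕ) :
    ∫ y in Set.Ioi ((n : ℝ) / lam), (occupiedSlots lam y : ℝ) ∂(expMeasure mu)
      = Real.exp (-(mu * (n / lam))) * (∫ y, (occupiedSlots lam y : ℝ) ∂(expMeasure mu) + n) := by
  have := isProbabilityMeasure_expMeasure hmu
  have hshift : (fun y => (occupiedSlots lam (y + n / lam) : ℝ)) =ᵐ[expMeasure mu]
      fun y => (occupiedSlots lam y : ℝ) + n := by
    filter_upwards [ae_pos_expMeasure hmu] with y hy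
    rw [occupiedSlots_add_div hlam hy.le, Nat.cast_add]
  rw [setIntegral_Ioi_expMeasure mu (by positivity), integral_congr_ae hshift,
    integral_add (integrable_occupiedSlots (integrable_id_expMeasure hmu) lam)
      (integrable_const _), integral_const, probReal_univ, one_smul]

/-- By memorylessness the mean `m` solves `m = (1 - e) + e * (m + 1)` with
`e = exp (-(mu / lam))`. -/
theorem integral_occupiedSlots (hlam : 0 < lam) (hmu : 0 < mu) :
    ∫ y, (occupiedSlots lam y : ℝ) ∂(expMeasure mu) = 1 / (1 - Real.exp (-(mu / lam))) := by
  have := isProbabilityMeasure_expMeasure hmu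
  have hfirst : ∫ y in Set.Ioc 0 (1 / lam), (occupiedSlots lam y : ℝ) ∂(expMeasure mu)
      = 1 - Real.exp (-(mu / lam)) := by
    rw [setIntegral_Ioc_expMeasure_of_eqOn_const (c := 1) hmu le_rfl (by positivity)]
    · rw [mul_zero, neg_zero, Real.exp_zero, mul_one_div, mul_one]
    · intro y hy
      have hone : occupiedSlots lam y = 0 + 1 :=
        (occupiedSlots_eq_succ_iff hlam).2 (by simpa using hy)
      simp [hone]
  have hrest := setIntegral_Ioi_occupiedSlots hlam hmu 1
  rw [Nat.cast_one, mul_one_div] at hrest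
  have hmean := setIntegral_Ioi_eq_Ioc_add_Ioi
    (integrable_occupiedSlots (integrable_id_expMeasure hmu) lam)
    (show (0 : ℝ) ≤ 1 / lam by positivity)
  rw [setIntegral_Ioi_zero_expMeasure hmu, hfirst, hrest] at hmean
  rw [eq_div_iff (one_sub_exp_pos hlam hmu).ne']
  linarith

/-- The mean violation time between two consecutive departures, given the length `x` of the first
of the two services. -/
noncomputable def conditionalViolation (lam mu d x : ℝ) : ℝ :=
  ∫ y, cycleViolation lam d (x, y) ∂(expMeasure mu)

theorem conditionalViolation_eq_integral_max (lam mu d x : ℝ) : conditionalViolation lam mu d x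
    = ∫ y, max 0 (y - (max x d - occupiedSlots lam x / lam)) ∂(expMeasure mu) := by
  simp only [conditionalViolation, cycleViolation, sub_sub_eq_add_sub, add_comm]

theorem conditionalViolation_of_le_slots (hmu : 0 < mu)
    (h : max x d ≤ occupiedSlots lam x / lam) :
    conditionalViolation lam mu d x = occupiedSlots lam x / lam - max x d + 1 / mu := by
  rw [conditionalViolation_eq_integral_max,
    integral_max_sub_expMeasure_of_nonpos hmu (sub_nonpos.2 h)]
  ring

theorem conditionalViolation_of_slots_le (hmu : 0 < mu) (hx : x ≤ d)
    (h : occupiedSlots lam x / lam ≤ d) : conditionalViolation lam mu d x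
      = Real.exp (-(mu * (d - occupiedSlots lam x / lam))) / mu := by
  rw [conditionalViolation_eq_integral_max, max_eq_right hx,
    integral_max_sub_expMeasure_of_nonneg hmu (sub_nonneg.2 h)]

theorem integrable_conditionalViolation (hmu : 0 < mu) (lam d : ℝ) :
    Integrable (conditionalViolation lam mu d) (expMeasure mu) := by
  have := isProbabilityMeasure_expMeasure hmu
  exact (integrable_cycleViolation (integrable_id_expMeasure hmu) lam d).integral_prod_left

theorem setIntegral_conditionalViolation_slot (hlam : 0 < lam) (hmu : 0 < mu) {n : ℕ}
    (hn : (n + 1 : ℕ) / lam ≤ d) :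
    ∫ x in Set.Ioc ((n : ℝ) / lam) ((n + 1 : ℕ) / lam), conditionalViolation lam mu d x
        ∂(expMeasure mu)
      = Real.exp (-(mu * d)) / mu * (Real.exp (mu / lam) - 1) := by
  rw [setIntegral_Ioc_expMeasure_of_eqOn_const
    (c := Real.exp (-(mu * (d - (n + 1 : ℕ) / lam))) / mu) hmu (by positivity)
    (by gcongr; omega)]
  · have hstart : Real.exp (-(mu * (n / lam)))
        = Real.exp (-(mu * ((n + 1 : ℕ) / lam))) * Real.exp (mu / lam) := by
      rw [← Real.exp_add]
      push_cast
      ring_nf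
    have hend : Real.exp (-(mu * (d - (n + 1 : ℕ) / lam)))
        = Real.exp (-(mu * d)) / Real.exp (-(mu * ((n + 1 : ℕ) / lam))) := by
      rw [← Real.exp_sub]
      ring_nf
    rw [hstart, hend]
    field_simp
  · intro x hx
    have hslots := (occupiedSlots_eq_succ_iff hlam).2 hx
    dsimp only
    rw [conditionalViolation_of_slots_le hmu (hx.2.trans hn) (by rwa [hslots]), hslots]

theorem setIntegral_conditionalViolation_Ioc_zero (hlam : 0 < lam) (hmu : 0 < mu) {n : ℕ}
    (hn : n / lam ≤ d) :
    ∫ x in Set.Ioc 0 (n / lam), conditionalViolation lam mu d x ∂(expMeasure mu)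
      = n * (Real.exp (-(mu * d)) / mu * (Real.exp (mu / lam) - 1)) := by
  induction n with
  | zero => simp
  | succ n ih =>
    have hle : (n : ℝ) / lam ≤ ((n + 1 : ℕ) : ℝ) / lam := by
      gcongr
      omega
    have hint := integrable_conditionalViolation hmu lam d
    rw [← Set.Ioc_union_Ioc_eq_Ioc (show (0 : ℝ) ≤ n / lam by positivity) hle,
      setIntegral_union (Set.Ioc_disjoint_Ioc_of_le le_rfl) measurableSet_Ioc hint.integrableOn
        hint.integrableOn, ih (hle.trans hn), setIntegral_conditionalViolation_slot hlam hmu hn]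
    push_cast
    ring

theorem setIntegral_conditionalViolation_Ioc_floor (hlam : 0 < lam) (hmu : 0 < mu) (hd : 0 ≤ d) :
    ∫ x in Set.Ioc ((⌊lam * d⌋₊ : ℝ) / lam) d, conditionalViolation lam mu d x ∂(expMeasure mu)
      = (Real.exp (-(mu * (⌊lam * d⌋₊ / lam))) - Real.exp (-(mu * d)))
        * (⌈lam * d⌉₊ / lam - d + 1 / mu) := by
  refine setIntegral_Ioc_expMeasure_of_eqOn_const hmu (by positivity) (floor_div_le hlam hd)
    fun x hx => ?_
  have hceil : d ≤ ⌈lam * d⌉₊ / lam := le_occupiedSlots_div hlam d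
  have hslots := occupiedSlots_eq_of_floor_lt hlam hx.1 (hx.2.trans hceil)
  rw [conditionalViolation_of_le_slots hmu (by rwa [max_eq_right hx.2, hslots]),
    max_eq_right hx.2, hslots]

theorem setIntegral_Ioi_occupiedSlots_div (hlam : 0 < lam) (hmu : 0 < mu) (hd : 0 ≤ d) :
    ∫ x in Set.Ioi d, (occupiedSlots lam x : ℝ) / lam ∂(expMeasure mu)
      = Real.exp (-(mu * (⌈lam * d⌉₊ / lam))) / (lam * (1 - Real.exp (-(mu / lam))))
        + Real.exp (-(mu * d)) * (⌈lam * d⌉₊ / lam) := by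
  have := isProbabilityMeasure_expMeasure hmu
  have hceil : d ≤ ⌈lam * d⌉₊ / lam := le_occupiedSlots_div hlam d
  have hconst : Set.EqOn (fun y => (occupiedSlots lam y : ℝ)) (fun _ => (⌈lam * d⌉₊ : ℝ))
      (Set.Ioc d (⌈lam * d⌉₊ / lam)) := fun y hy => by
    dsimp only
    rw [occupiedSlots_eq_of_floor_lt hlam ((floor_div_le hlam hd).trans_lt hy.1) hy.2]
  rw [integral_div, setIntegral_Ioi_eq_Ioc_add_Ioi
      (integrable_occupiedSlots (integrable_id_expMeasure hmu) lam) hceil,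
    setIntegral_Ioi_occupiedSlots hlam hmu,
    setIntegral_Ioc_expMeasure_of_eqOn_const hmu hd hceil hconst,
    integral_occupiedSlots hlam hmu]
  have hp := (one_sub_exp_pos hlam hmu).ne'
  field_simp
  ring

theorem setIntegral_conditionalViolation_Ioi (hlam : 0 < lam) (hmu : 0 < mu) (hd : 0 ≤ d) :
    ∫ x in Set.Ioi d, conditionalViolation lam mu d x ∂(expMeasure mu)
      = Real.exp (-(mu * (⌈lam * d⌉₊ / lam))) / (lam * (1 - Real.exp (-(mu / lam))))
        + Real.exp (-(mu * d)) * (⌈lam * d⌉₊ / lam - d) := by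
  have := isProbabilityMeasure_expMeasure hmu
  have hcond : Set.EqOn (conditionalViolation lam mu d)
      (fun x => (occupiedSlots lam x : ℝ) / lam - (x - 1 / mu)) (Set.Ioi d) := fun x hx => by
    have hmax : max x d = x := max_eq_left (le_of_lt hx)
    rw [conditionalViolation_of_le_slots hmu (hmax.trans_le (le_occupiedSlots_div hlam x)), hmax]
    ring
  have hid := integrable_id_expMeasure hmu
  have hexcess : ∫ x in Set.Ioi d, (x - 1 / mu) ∂(expMeasure mu) = Real.exp (-(mu * d)) * d := by
    rw [setIntegral_Ioi_expMeasure mu hd (fun x => x - 1 / mu)]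
    simp_rw [add_sub_assoc]
    rw [integral_add hid (integrable_const _), integral_id_expMeasure hmu, integral_const,
      probReal_univ, one_smul, add_sub_cancel]
  rw [setIntegral_congr_fun measurableSet_Ioi hcond,
    integral_sub ((integrable_occupiedSlots hid lam).div_const lam).integrableOn
      (by exact (hid.sub (integrable_const (1 / mu))).integrableOn),
    setIntegral_Ioi_occupiedSlots_div hlam hmu hd, hexcess]
  ring

theorem integral_cycleLength_expMeasure (hlam : 0 < lam) (hmu : 0 < mu) :
    ∫ z, cycleLength lam z ∂((expMeasure mu).prod (expMeasure mu)) = 1 / nuDM11 lam mu := by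
  have := isProbabilityMeasure_expMeasure hmu
  rw [integral_cycleLength (integrable_id_expMeasure hmu), integral_occupiedSlots hlam hmu,
    nuDM11, neg_div, div_div, mul_comm lam]

theorem integral_cycleViolation_expMeasure (hlam : 0 < lam) (hmu : 0 < mu) (hd : 0 ≤ d) :
    ∫ z, cycleViolation lam d z ∂((expMeasure mu).prod (expMeasure mu))
      = meanDurationDM11 lam mu d := by
  have := isProbabilityMeasure_expMeasure hmu
  have hint := integrable_conditionalViolation hmu lam d
  have hcond : ∫ z, cycleViolation lam d z ∂((expMeasure mu).prod (expMeasure mu))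
      = ∫ x, conditionalViolation lam mu d x ∂(expMeasure mu) :=
    integral_prod _ (integrable_cycleViolation (integrable_id_expMeasure hmu) lam d)
  rw [hcond, ← setIntegral_Ioi_zero_expMeasure hmu,
    setIntegral_Ioi_eq_Ioc_add_Ioi hint (show (0 : ℝ) ≤ ⌊lam * d⌋₊ / lam by positivity),
    setIntegral_Ioi_eq_Ioc_add_Ioi hint (floor_div_le hlam hd),
    setIntegral_conditionalViolation_Ioc_zero hlam hmu (floor_div_le hlam hd),
    setIntegral_conditionalViolation_Ioc_floor hlam hmu hd,
    setIntegral_conditionalViolation_Ioi hlam hmu hd, meanDurationDM11,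
    ← natCast_floor_eq_intCast_floor (by positivity),
    ← natCast_ceil_eq_intCast_ceil (by positivity)]
  simp only [neg_mul, neg_div]
  ring

end ExponentialMeans

section Renewal

open Finset.HasAntidiagonal (antidiagonal)
open scoped ENNReal

variable {Ω : Type*} [MeasurableSpace Ω] {P : Measure Ω}

theorem measure_add_eq_sum_antidiagonal {ι : Type*} [AddMonoid ι] [Finset.HasAntidiagonal ι]
    [MeasurableSpace ι] [MeasurableSingletonClass ι] {N M : Ω → ι} (hN : Measurable N)
    (hM : Measurable M) (hNM : IndepFun N M P) (n : ι) :
    P {ω | N ω + M ω = n}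
      = ∑ p ∈ antidiagonal n, P {ω | N ω = p.1} * P {ω | M ω = p.2} := by
  have hset : {ω | N ω + M ω = n} = ⋃ p ∈ antidiagonal n, N ⁻¹' {p.1} ∩ M ⁻¹' {p.2} := by
    ext ω
    simp
  rw [hset, measure_biUnion_finset]
  · exact Finset.sum_congr rfl fun p _ => hNM.measure_inter_preimage_eq_mul _ _
      (measurableSet_singleton _) (measurableSet_singleton _)
  · intro p _ p' _ hne
    refine Set.disjoint_left.2 fun ω hω hω' => hne (Prod.ext ?_ ?_)
    · exact hω.1.symm.trans hω'.1
    · exact hω.2.symm.trans hω'.2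
  · exact fun p _ => (hN (measurableSet_singleton _)).inter (hM (measurableSet_singleton _))

variable {M : ℕ → Ω → ℕ} {f : ℕ → ℝ≥0∞}

theorem tsum_measure_partialSum_eq_zero [IsProbabilityMeasure P]
    (hlaw : ∀ n, P {ω | M 0 ω = n} = f n) (hf : f 0 = 0) :
    ∑' k, P {ω | ∑ j ∈ Finset.range k, M j ω = 0} = 1 := by
  have hsucc (k : ℕ) : P {ω | ∑ j ∈ Finset.range (k + 1), M j ω = 0} = 0 :=
    measure_mono_null (fun ω hω => Finset.sum_eq_zero_iff.1 hω 0 (Finset.mem_range.2 k.succ_pos))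
      ((hlaw 0).trans hf)
  rw [tsum_eq_zero_add' ENNReal.summable]
  simp only [hsucc, tsum_zero, add_zero, Finset.range_zero, Finset.sum_empty, Set.ofPred_true,
    measure_univ]

theorem tsum_measure_partialSum_eq_succ (hM : ∀ k, Measurable (M k)) (hind : iIndepFun M P)
    (hlaw : ∀ k n, P {ω | M k ω = n} = f n) (hf : f 0 = 0) (n : ℕ) :
    ∑' k, P {ω | ∑ j ∈ Finset.range k, M j ω = n + 1}
      = ∑ p ∈ antidiagonal n,
        (∑' k, P {ω | ∑ j ∈ Finset.range k, M j ω = p.1}) * f (p.2 + 1) := by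
  have hsucc (k : ℕ) : P {ω | ∑ j ∈ Finset.range (k + 1), M j ω = n + 1}
      = ∑ p ∈ antidiagonal n,
        P {ω | ∑ j ∈ Finset.range k, M j ω = p.1} * f (p.2 + 1) := by
    have hindep : IndepFun (fun ω => ∑ j ∈ Finset.range k, M j ω) (M k) P := by
      simpa only [Finset.sum_fn] using hind.indepFun_sum_range_succ hM k
    simp only [Finset.sum_range_succ]
    rw [measure_add_eq_sum_antidiagonal (Finset.measurable_fun_sum _ fun j _ => hM j) (hM k)
      hindep, Finset.Nat.sum_antidiagonal_succ', hlaw, hf, mul_zero, zero_add]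
    simp only [hlaw]
  rw [tsum_eq_zero_add' ENNReal.summable]
  simp only [hsucc, ← ENNReal.tsum_mul_right]
  rw [Summable.tsum_finsetSum fun _ _ => ENNReal.summable]
  simp

theorem eq_of_geometric_renewal {R : Type*} [CommSemiring R] {u : ℕ → R} {p q : R}
    (hpq : p + q = 1) (hzero : u 0 = 1)
    (hsucc : ∀ n, u (n + 1) = ∑ i ∈ antidiagonal n, u i.1 * (q ^ i.2 * p)) (n : ℕ) :
    u (n + 1) = p := by
  induction n with
  | zero => simp [hsucc, hzero]
  | succ n ih =>
    have hstep : u (n + 2) = u (n + 1) * p + q * u (n + 1) := by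
      rw [hsucc (n + 1), Finset.Nat.sum_antidiagonal_succ', pow_zero, one_mul]
      congr 1
      rw [hsucc n, Finset.mul_sum]
      refine Finset.sum_congr rfl fun i _ => ?_
      rw [pow_succ]
      ring
    rw [hstep, ih, mul_comm q, ← mul_add, hpq, mul_one]

theorem tsum_measure_partialSum_eq_succ_of_geometric [IsProbabilityMeasure P] {p q : ℝ≥0∞}
    (hpq : p + q = 1) (hM : ∀ k, Measurable (M k)) (hind : iIndepFun M P)
    (hzero : ∀ k, P {ω | M k ω = 0} = 0) (hsucc : ∀ k n, P {ω | M k ω = n + 1} = q ^ n * p)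
    (n : ℕ) : ∑' k, P {ω | ∑ j ∈ Finset.range k, M j ω = n + 1} = p := by
  let f : ℕ → ℝ≥0∞ := fun n => n.casesOn 0 fun m => q ^ m * p
  have hlaw (k n : ℕ) : P {ω | M k ω = n} = f n := by
    cases n with
    | zero => exact hzero k
    | succ n => exact hsucc k n
  exact eq_of_geometric_renewal (u := fun n => ∑' k, P {ω | ∑ j ∈ Finset.range k, M j ω = n}) hpq
    (tsum_measure_partialSum_eq_zero (hlaw 0) rfl)
    (tsum_measure_partialSum_eq_succ hM hind hlaw rfl) n

end Renewal

section Independence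

open scoped ENNReal

variable {Ω α β γ : Type*} [MeasurableSpace Ω] [MeasurableSpace α] [MeasurableSpace β]
  [MeasurableSpace γ] {P : Measure Ω} {f : Ω → α} {g : Ω → β} {h : Ω → γ}

theorem indepFun_prodMk_left [IsFiniteMeasure P] (hf : Measurable f) (hg : Measurable g)
    (hh : Measurable h) (hfgh : IndepFun f (fun ω => (g ω, h ω)) P) (hgh : IndepFun g h P) :
    IndepFun (fun ω => (f ω, g ω)) h P := by
  have hfg : IndepFun f g P := hfgh.comp measurable_id measurable_fst
  rw [indepFun_iff_map_prod_eq_prod_map_map (hf.prodMk hg).aemeasurable hh.aemeasurable,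
    hfg.map_prod_eq_prod_map_map hf.aemeasurable hg.aemeasurable]
  apply (MeasurableEquiv.prodAssoc : (α × β) × γ ≃ᵐ α × β × γ).map_measurableEquiv_injective
  rw [Measure.prodAssoc_prod, ← hgh.map_prod_eq_prod_map_map hg.aemeasurable hh.aemeasurable,
    ← hfgh.map_prod_eq_prod_map_map hf.aemeasurable (hg.prodMk hh).aemeasurable,
    Measure.map_map MeasurableEquiv.prodAssoc.measurable ((hf.prodMk hg).prodMk hh)]
  rfl

theorem measure_prodMk_mem_eq_lintegral [IsFiniteMeasure P] (hf : Measurable f)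
    (hg : Measurable g) (hfg : IndepFun f g P) {C : Set (α × β)} (hC : MeasurableSet C) :
    P {ω | (f ω, g ω) ∈ C} = ∫⁻ ω, P.map g {b | (f ω, b) ∈ C} ∂P := by
  rw [← lintegral_map (f := fun a => P.map g {b | (a, b) ∈ C}) (measurable_measure_prodMk_left hC)
    hf]
  exact (Measure.map_apply (hf.prodMk hg) hC).symm.trans <| by
    rw [hfg.map_prod_eq_prod_map_map hf.aemeasurable hg.aemeasurable, Measure.prod_apply hC]
    rfl

theorem lintegral_comp_prodMk_eq_tsum [IsFiniteMeasure P] [Countable β]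
    [MeasurableSingletonClass β] (hf : Measurable f) (hg : Measurable g) (hfg : IndepFun f g P)
    {F : α → β → ℝ≥0∞} (hF : ∀ b, Measurable fun a => F a b) :
    ∫⁻ ω, F (f ω) (g ω) ∂P = ∑' b, P {ω | g ω = b} * ∫⁻ ω, F (f ω) b ∂P := by
  have hF' : Measurable fun p : α × β => F p.1 p.2 := measurable_from_prod_countable_left hF
  rw [← lintegral_map (f := fun p : α × β => F p.1 p.2) hF' (hf.prodMk hg),
    hfg.map_prod_eq_prod_map_map hf.aemeasurable hg.aemeasurable,
    lintegral_prod_symm' _ hF', lintegral_countable']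
  refine tsum_congr fun b => ?_
  rw [lintegral_map (hF b) hf, Measure.map_apply hg (measurableSet_singleton b), mul_comm]
  rfl

end Independence

section UniformPhase

open scoped ENNReal

theorem lintegral_comp_add_of_isUniform {Ω : Type*} [MeasurableSpace Ω] {P : Measure Ω}
    {φ : Ω → ℝ} (hφ : Measurable φ) {c : ℝ} (hu : pdf.IsUniform φ (Set.Ico 0 c) P volume)
    {F : ℝ → ℝ≥0∞} (hF : Measurable F) (b : ℝ) :
    ∫⁻ ω, F (φ ω + b) ∂P = (ENNReal.ofReal c)⁻¹ * ∫⁻ y in Set.Ico b (b + c), F y := by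
  have hpre : Set.Ico 0 c = (fun y : ℝ => y + b) ⁻¹' Set.Ico b (b + c) := by
    rw [Set.preimage_add_const_Ico, sub_self, add_sub_cancel_left]
  rw [← lintegral_map (f := fun y => F (y + b)) (hF.comp (measurable_add_const b)) hφ, hu,
    ProbabilityTheory.cond,
    lintegral_smul_measure, Real.volume_Ico, sub_zero, smul_eq_mul, hpre,
    (measurePreserving_add_right volume b).setLIntegral_comp_preimage measurableSet_Ico hF]

theorem tsum_setLIntegral_Ico_nat_mul {c : ℝ} (hc : 0 < c) (F : ℝ → ℝ≥0∞) :
    ∑' n : ℕ, ∫⁻ y in Set.Ico (n * c) (n * c + c), F y = ∫⁻ y in Set.Ici 0, F y := by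
  have hmono : Monotone fun n : ℕ => n * c := fun m n hmn => by
    dsimp only
    gcongr
  have hunion := iUnion_Ico_succ_eq_Ici hmono (tendsto_natCast_atTop_atTop.atTop_mul_const hc)
  rw [Nat.cast_zero, zero_mul] at hunion
  simp only [← add_one_mul, ← Nat.cast_add_one]
  rw [← hunion]
  exact (lintegral_iUnion (fun _ => measurableSet_Ico) hmono.pairwise_disjoint_on_Ico_succ F).symm

end UniformPhase

section UniformArrivals

open scoped ENNReal

theorem expMeasure_occupiedSlots_eq_succ {lam mu : ℝ} (hlam : 0 < lam) (hmu : 0 < mu) (n : ℕ) :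
    expMeasure mu {y | occupiedSlots lam y = n + 1}
      = ENNReal.ofReal (Real.exp (-(mu / lam))) ^ n
        * ENNReal.ofReal (1 - Real.exp (-(mu / lam))) := by
  have := isProbabilityMeasure_expMeasure hmu
  simp only [occupiedSlots_eq_succ_iff hlam, Set.ofPred_mem_eq]
  rw [← ofReal_measureReal, measureReal_expMeasure_Ioc hmu (by positivity) (by gcongr; simp),
    ← ENNReal.ofReal_pow (Real.exp_pos _).le, ← ENNReal.ofReal_mul (by positivity),
    ← Real.exp_nat_mul, mul_sub, ← Real.exp_add, mul_one]
  congr 3 <;> push_cast <;> ring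

/-- The probability, for service times of law `ρ`, that the packet whose service started `w` units
of time ago is the last one that has departed, and gives an age of at most `d`. -/
noncomputable def freshProb (ρ : Measure ℝ) (lam d w : ℝ) : ℝ≥0∞ :=
  (ρ.prod ρ) {z | z.1 ≤ w ∧ w < occupiedSlots lam z.1 / lam + z.2 ∧ w ≤ d}

theorem measurableSet_fresh (lam d : ℝ) :
    MeasurableSet {p : ℝ × (ℝ × ℝ) |
      p.2.1 ≤ p.1 ∧ p.1 < occupiedSlots lam p.2.1 / lam + p.2.2 ∧ p.1 ≤ d} := by
  have hnext : Measurable fun p : ℝ × (ℝ × ℝ) => occupiedSlots lam p.2.1 / lam + p.2.2 := by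
    fun_prop
  exact (measurableSet_le measurable_snd.fst measurable_fst).inter <|
    (measurableSet_lt measurable_fst hnext).inter (measurableSet_le measurable_fst measurable_const)

theorem measurable_freshProb (ρ : Measure ℝ) [SFinite ρ] (lam d : ℝ) :
    Measurable (freshProb ρ lam d) :=
  measurable_measure_prodMk_left (measurableSet_fresh lam d)

theorem freshProb_of_lt {ρ : Measure ℝ} {lam d w : ℝ} (hw : d < w) : freshProb ρ lam d w = 0 := by
  simp [freshProb, hw.not_ge]

end UniformArrivals

namespace IsDGI11

open scoped ENNReal

variable {Ω : Type*} [MeasurableSpace Ω] {P : Measure Ω} {ρ : Measure ℝ}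
  {X : ℕ → Ω → ℝ} {φ : Ω → ℝ} {lam mu d a₀ t : ℝ}

theorem tsum_measure_startSlot_eq_succ [IsProbabilityMeasure P]
    (h : IsDGI11 P (expMeasure mu) X φ) (hlam : 0 < lam) (hmu : 0 < mu) (n : ℕ) :
    ∑' k, P {ω | startSlot lam X k ω = n + 1} = ENNReal.ofReal (1 - Real.exp (-(mu / lam))) := by
  have hpos := (one_sub_exp_pos hlam hmu).le
  have hlaw (k : ℕ) (s : Set ℝ) (hs : MeasurableSet s) : P {ω | X k ω ∈ s} = expMeasure mu s := by
    rw [← h.map_service k, Measure.map_apply (h.measurable_service k) hs]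
    rfl
  refine tsum_measure_partialSum_eq_succ_of_geometric
    (p := ENNReal.ofReal (1 - Real.exp (-(mu / lam))))
    (q := ENNReal.ofReal (Real.exp (-(mu / lam)))) ?_
    (fun k => (measurable_occupiedSlots lam).comp (h.measurable_service k))
    (h.iIndepFun_service.comp _ fun _ => measurable_occupiedSlots lam) (fun k => ?_)
    (fun k m => ?_) n
  · rw [← ENNReal.ofReal_add hpos (Real.exp_pos _).le, sub_add_cancel, ENNReal.ofReal_one]
  · refine measure_mono_null ?_ (ae_iff.1 h.ae_service_pos)
    exact fun ω hω hX => (occupiedSlots_pos hlam (hX k)).ne' hω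
  · rw [← expMeasure_occupiedSlots_eq_succ hlam hmu m]
    exact hlaw k _ (measurable_occupiedSlots lam (measurableSet_singleton _))

theorem indepFun_phase_startSlot_pair (h : IsDGI11 P ρ X φ) (lam : ℝ) (k : ℕ) :
    IndepFun φ (fun ω => (startSlot lam X k ω, (X k ω, X (k + 1) ω))) P := by
  refine h.indepFun_phase.comp measurable_id (ψ := fun v : ℕ → ℝ =>
    (∑ j ∈ Finset.range k, occupiedSlots lam (v j), (v k, v (k + 1)))) ?_
  exact (Finset.measurable_fun_sum _ fun j _ => by fun_prop).prodMk (by fun_prop)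

theorem indepFun_startSlot_pair (h : IsDGI11 P ρ X φ) (lam : ℝ) (k : ℕ) :
    IndepFun (startSlot lam X k) (fun ω => (X k ω, X (k + 1) ω)) P := by
  have hdisj : Disjoint (Finset.range k) {k, k + 1} := by simp
  have hsum : Measurable fun v : Finset.range k → ℝ => ∑ j, occupiedSlots lam (v j) :=
    Finset.measurable_fun_sum _ fun j _ => by fun_prop
  have hpair : Measurable fun v : ({k, k + 1} : Finset ℕ) → ℝ =>
      (v ⟨k, by simp⟩, v ⟨k + 1, by simp⟩) := by fun_prop
  refine ((h.iIndepFun_service.indepFun_finset _ _ hdisj h.measurable_service).comp hsum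
    hpair).congr (ae_of_all _ fun ω => ?_) (ae_eq_refl _)
  exact Finset.sum_coe_sort (Finset.range k) fun j => occupiedSlots lam (X j ω)

theorem ae_fresh_iff (h : IsDGI11 P ρ X φ) (hlam : 0 < lam) (d t : ℝ) :
    ∀ᵐ ω ∂P, ∀ k, (X k ω ≤ t - serviceStart lam X φ k ω ∧
        t - serviceStart lam X φ k ω < occupiedSlots lam (X k ω) / lam + X (k + 1) ω ∧
        t - serviceStart lam X φ k ω ≤ d) ↔
      t ∈ Set.Ico (departureTime (periodicArrivals lam (φ ω)) (fun j => X j ω) k)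
          (departureTime (periodicArrivals lam (φ ω)) (fun j => X j ω) (k + 1)) ∧
        t - arrivalTime (periodicArrivals lam (φ ω)) (fun j => X j ω) k ≤ d := by
  filter_upwards [h.ae_service_pos, h.ae_arrivalTime_eq hlam] with ω hpos harr k
  rw [Set.mem_Ico, departureTime_succ_periodicArrivals hlam hpos, departureTime, harr, and_assoc,
    le_sub_iff_add_le', sub_lt_iff_lt_add',
    add_assoc _ (occupiedSlots lam (X k ω) / lam : ℝ)]

variable [IsProbabilityMeasure P]

theorem indepFun_serviceStart_pair (h : IsDGI11 P ρ X φ) (lam : ℝ) (k : ℕ) :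
    IndepFun (serviceStart lam X φ k) (fun ω => (X k ω, X (k + 1) ω)) P := by
  have hindep := indepFun_prodMk_left h.measurable_phase (h.measurable_startSlot lam k)
    (h.measurable_pair k) (h.indepFun_phase_startSlot_pair lam k) (h.indepFun_startSlot_pair lam k)
  exact hindep.comp (φ := fun p : ℝ × ℕ => p.1 + p.2 / lam) (by fun_prop) measurable_id

theorem measure_fresh (h : IsDGI11 P ρ X φ) (lam d t : ℝ) (k : ℕ) :
    P {ω | X k ω ≤ t - serviceStart lam X φ k ω ∧
        t - serviceStart lam X φ k ω < occupiedSlots lam (X k ω) / lam + X (k + 1) ω ∧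
        t - serviceStart lam X φ k ω ≤ d}
      = ∫⁻ ω, freshProb ρ lam d (t - serviceStart lam X φ k ω) ∂P := by
  have hindep := (h.indepFun_serviceStart_pair lam k).comp (φ := fun a => t - a)
    (measurable_const.sub measurable_id) measurable_id
  simp only [freshProb, ← h.map_pair k]
  exact measure_prodMk_mem_eq_lintegral (measurable_const.sub (h.measurable_serviceStart lam k))
    (h.measurable_pair k) hindep (measurableSet_fresh lam d)

theorem measure_age_le (h : IsDGI11 P ρ X φ) (hlam : 0 < lam) (ha₀ : 0 ≤ a₀) (ht : d < t) :
    P {ω | ageOfInformation (periodicArrivals lam (φ ω)) (fun j => X j ω) a₀ t ≤ d}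
      = ∑' k, ∫⁻ ω, freshProb ρ lam d (t - serviceStart lam X φ k ω) ∂P := by
  have hfresh := h.ae_fresh_iff hlam d t
  simp only [← h.measure_fresh]
  rw [← measure_iUnion₀]
  · refine measure_congr ?_
    filter_upwards [h.ae_service_pos, h.phase_nonneg, hfresh] with ω hpos hφ hω
    refine propext (Iff.trans ?_ Set.mem_iUnion.symm)
    simp only [Set.mem_ofPred_eq, hω]
    refine (ageOfInformation_le_iff (tendsto_periodicArrivals hlam _) (fun k => (hpos k).le)
      (by rw [periodicArrivals_zero]; linarith)).trans (or_iff_right fun hearly => ?_)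
    linarith [hearly.2]
  · intro i j hij
    refine measure_mono_null ?_ (ae_iff.1 (h.ae_service_pos.and hfresh))
    rintro ω hω ⟨hpos, hiff⟩
    have hmono := monotone_departureTime (tendsto_periodicArrivals hlam (φ ω)) fun k => (hpos k).le
    exact Set.disjoint_left.1 (hmono.pairwise_disjoint_on_Ico_succ hij)
      ((hiff i).1 hω.1).1 ((hiff j).1 hω.2).1
  · exact fun k => (((measurable_const.sub (h.measurable_serviceStart lam k)).prodMk
      (h.measurable_pair k)) (measurableSet_fresh lam d)).nullMeasurableSet

theorem lintegral_comp_serviceStart (h : IsDGI11 P ρ X φ) (lam : ℝ) {F : ℝ → ℝ≥0∞}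
    (hF : Measurable F) (k : ℕ) :
    ∫⁻ ω, F (serviceStart lam X φ k ω) ∂P
      = ∑' n : ℕ, P {ω | startSlot lam X k ω = n} * ∫⁻ ω, F (φ ω + n / lam) ∂P :=
  lintegral_comp_prodMk_eq_tsum (F := fun a (n : ℕ) => F (a + n / lam)) h.measurable_phase
    (h.measurable_startSlot lam k)
    ((h.indepFun_phase_startSlot_pair lam k).comp measurable_id measurable_fst)
    fun _ => hF.comp (measurable_add_const _)

/-- That is, service starts after time `1 / lam` have the constant intensity `p * lam`. -/
theorem tsum_lintegral_comp_serviceStart_of_isUniform (h : IsDGI11 P ρ X φ) (hlam : 0 < lam)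
    (hu : pdf.IsUniform φ (Set.Ico 0 (1 / lam)) P volume) {p : ℝ≥0∞}
    (hp : ∀ n, ∑' k, P {ω | startSlot lam X k ω = n + 1} = p) {F : ℝ → ℝ≥0∞}
    (hF : Measurable F) (hF0 : ∀ a < 1 / lam, F a = 0) :
    ∑' k, ∫⁻ ω, F (serviceStart lam X φ k ω) ∂P
      = p * ((ENNReal.ofReal (1 / lam))⁻¹ * ∫⁻ a, F a) := by
  have hone : 0 < 1 / lam := by positivity
  have hslot (n : ℕ) : ∫⁻ ω, F (φ ω + n / lam) ∂P = (ENNReal.ofReal (1 / lam))⁻¹ *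
      ∫⁻ a in Set.Ico (n * (1 / lam)) (n * (1 / lam) + 1 / lam), F a := by
    rw [lintegral_comp_add_of_isUniform h.measurable_phase hu hF, mul_one_div]
  have hfirst : ∫⁻ a in Set.Ico ((0 : ℕ) * (1 / lam)) ((0 : ℕ) * (1 / lam) + 1 / lam), F a = 0 :=
    setLIntegral_eq_zero measurableSet_Ico fun a ha => hF0 a (by simpa using ha.2)
  have hweight (n : ℕ) : (∑' k, P {ω | startSlot lam X k ω = n}) * ∫⁻ ω, F (φ ω + n / lam) ∂P
      = p * ((ENNReal.ofReal (1 / lam))⁻¹ *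
        ∫⁻ a in Set.Ico (n * (1 / lam)) (n * (1 / lam) + 1 / lam), F a) := by
    rw [hslot]
    cases n with
    | zero => rw [hfirst, mul_zero, mul_zero, mul_zero]
    | succ n => rw [hp]
  simp only [h.lintegral_comp_serviceStart lam hF]
  rw [ENNReal.tsum_comm]
  simp only [ENNReal.tsum_mul_right, hweight, ENNReal.tsum_mul_left]
  rw [tsum_setLIntegral_Ico_nat_mul hone, setLIntegral_eq_of_support_subset]
  exact fun a ha => hone.le.trans (not_lt.1 fun hlt => ha (hF0 a hlt))

theorem eventually_measure_age_le_eq (h : IsDGI11 P ρ X φ) (hlam : 0 < lam) (ha₀ : 0 ≤ a₀)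
    (hu : pdf.IsUniform φ (Set.Ico 0 (1 / lam)) P volume) {p : ℝ≥0∞}
    (hp : ∀ n, ∑' k, P {ω | startSlot lam X k ω = n + 1} = p) (d : ℝ) :
    ∀ᶠ t in atTop,
      P {ω | ageOfInformation (periodicArrivals lam (φ ω)) (fun j => X j ω) a₀ t ≤ d}
        = p * ((ENNReal.ofReal (1 / lam))⁻¹ * ∫⁻ w, freshProb ρ lam d w) := by
  have := h.isProbabilityMeasure
  have hone : 0 < 1 / lam := by positivity
  filter_upwards [eventually_gt_atTop (d + 1 / lam)] with t ht
  rw [h.measure_age_le hlam ha₀ (by linarith),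
    h.tsum_lintegral_comp_serviceStart_of_isUniform hlam hu hp
      (F := fun a => freshProb ρ lam d (t - a))
      ((measurable_freshProb ρ lam d).comp (measurable_const.sub measurable_id))
      fun a ha => freshProb_of_lt (by linarith),
    lintegral_sub_left_eq_self]

theorem exists_tendsto_violation_of_isUniform (h : IsDGI11 P ρ X φ) (hlam : 0 < lam)
    (ha₀ : 0 ≤ a₀) (hu : pdf.IsUniform φ (Set.Ico 0 (1 / lam)) P volume) {p : ℝ≥0∞}
    (hp : ∀ n, ∑' k, P {ω | startSlot lam X k ω = n + 1} = p) (d : ℝ) :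
    ∃ v, Tendsto (fun t => P.real {ω |
      d < ageOfInformation (periodicArrivals lam (φ ω)) (fun j => X j ω) a₀ t}) atTop (𝓝 v) := by
  refine ⟨1 - (p * ((ENNReal.ofReal (1 / lam))⁻¹ * ∫⁻ w, freshProb ρ lam d w)).toReal,
    tendsto_nhds_of_eventually_eq ?_⟩
  filter_upwards [h.eventually_measure_age_le_eq hlam ha₀ hu hp d] with t ht
  rw [← ht, ← measureReal_def, eq_sub_iff_add_eq, ← probReal_univ (μ := P),
    ← measureReal_add_measureReal_compl₀ (h.nullMeasurableSet_violation hlam ha₀ d t)]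
  simp only [Set.compl_ofPred, not_lt]

end IsDGI11

theorem mainTheorem6_general {Ω : Type*} [MeasurableSpace Ω] (P : Measure Ω)
    [IsProbabilityMeasure P] (lam mu d a₀ : ℝ) (hlam : 0 < lam) (hmu : 0 < mu) (hd : 0 ≤ d)
    (ha₀ : 0 ≤ a₀)
    (X : ℕ → Ω → ℝ) (hX : ∀ k, Measurable (X k)) (hXlaw : ∀ k, P.map (X k) = expMeasure mu)
    (hXindep : iIndepFun X P)
    (φ : Ω → ℝ) (hφ : Measurable φ) (hφ0 : ∀ᵐ ω ∂P, 0 ≤ φ ω)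
    (hφX : IndepFun φ (fun ω k => X k ω) P) :
    let τ : Ω → ℕ → ℝ := fun ω => periodicArrivals lam (φ ω)
    let x : Ω → ℕ → ℝ := fun ω k => X k ω
    let Δ : ℝ → Ω → ℝ := fun t ω => ageOfInformation (τ ω) (x ω) a₀ t
    let interDep : ℕ → Ω → ℝ :=
      fun k ω => departureTime (τ ω) (x ω) (k + 1) - departureTime (τ ω) (x ω) k
    let g : ℕ → Ω → ℝ := fun k ω => violationDuration (τ ω) (x ω) a₀ d k
    (∀ k, Integrable (interDep k) P ∧ 1 / (∫ ω, interDep k ω ∂P) = nuDM11 lam mu) ∧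
    (∀ k, Integrable (g k) P ∧ ∫ ω, g k ω ∂P = meanDurationDM11 lam mu d) ∧
    (∀ᵐ ω ∂P, Tendsto (fun T : ℝ => volume.real {t : ℝ | t ∈ Set.Icc 0 T ∧ d < Δ t ω} / T) atTop
      (𝓝 (nuDM11 lam mu * meanDurationDM11 lam mu d))) ∧
    (∀ v : ℝ, Tendsto (fun t : ℝ => P.real {ω | d < Δ t ω}) atTop (𝓝 v) →
      v = nuDM11 lam mu * meanDurationDM11 lam mu d) ∧
    (pdf.IsUniform φ (Set.Ico 0 (1 / lam)) P volume →
      Tendsto (fun t : ℝ => P.real {ω | d < Δ t ω}) atTop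
        (𝓝 (nuDM11 lam mu * meanDurationDM11 lam mu d))) := by
  intro τ x Δ interDep g
  have h : IsDGI11 P (expMeasure mu) X φ :=
    ⟨hX, hXlaw, hXindep, ae_pos_expMeasure hmu, hφ, hφ0, hφX⟩
  have hρ := integrable_id_expMeasure hmu
  have hlength := integral_cycleLength_expMeasure hlam hmu
  have hviolation := integral_cycleViolation_expMeasure hlam hmu hd
  have hratio : (∫ z, cycleViolation lam d z ∂((expMeasure mu).prod (expMeasure mu)))
      / ∫ z, cycleLength lam z ∂((expMeasure mu).prod (expMeasure mu))
      = nuDM11 lam mu * meanDurationDM11 lam mu d := by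
    rw [hlength, hviolation, div_div_eq_mul_div, div_one, mul_comm]
  have hlimit (v : ℝ) (hv : Tendsto (fun t : ℝ => P.real {ω | d < Δ t ω}) atTop (𝓝 v)) :
      v = nuDM11 lam mu * meanDurationDM11 lam mu d :=
    (h.eq_of_tendsto_violation hρ hlam ha₀ hv).trans hratio
  refine ⟨fun k => ⟨h.integrable_departureTime_succ_sub hρ hlam k, ?_⟩,
    fun k => ⟨h.integrable_violationDuration hρ hlam ha₀ d k,
      (h.integral_violationDuration hlam ha₀ d k).trans hviolation⟩,
    hratio ▸ h.ae_tendsto_violation_fraction hρ hlam ha₀ d, hlimit, fun hu => ?_⟩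
  · rw [h.integral_departureTime_succ_sub hlam k, hlength, one_div_one_div]
  · obtain ⟨v, hv⟩ := h.exists_tendsto_violation_of_isUniform hlam ha₀ hu
      (h.tsum_measure_startSlot_eq_succ hlam hmu) d
    exact hlimit v hv ▸ hv

theorem mainTheorem6 {Ω : Type*} [MeasurableSpace Ω] (P : Measure Ω) [IsProbabilityMeasure P]
    (lam mu d a₀ : ℝ) (hlam : 0 < lam) (hmu : 0 < mu) (hd : 1 / lam ≤ d) (ha₀ : 0 ≤ a₀)
    -- service times: i.i.d. exponential with mean `1 / mu`
    (X : ℕ → Ω → ℝ) (hX : ∀ k, Measurable (X k)) (hXlaw : ∀ k, P.map (X k) = expMeasure mu)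
    (hXindep : iIndepFun X P)
    -- time of the first arrival (constant or random), independent of the service times
    (φ : Ω → ℝ) (hφ : Measurable φ) (hφ0 : ∀ᵐ ω ∂P, 0 ≤ φ ω)
    (hφX : IndepFun φ (fun ω k => X k ω) P) :
    let τ : Ω → ℕ → ℝ := fun ω => periodicArrivals lam (φ ω)
    let x : Ω → ℕ → ℝ := fun ω k => X k ω
    let Δ : ℝ → Ω → ℝ := fun t ω => ageOfInformation (τ ω) (x ω) a₀ t
    let interDep : ℕ → Ω → ℝ :=
      fun k ω => departureTime (τ ω) (x ω) (k + 1) - departureTime (τ ω) (x ω) k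
    let g : ℕ → Ω → ℝ := fun k ω => violationDuration (τ ω) (x ω) a₀ d k
    -- the departure rate
    (∀ k, Integrable (interDep k) P ∧ 1 / (∫ ω, interDep k ω ∂P) = nuDM11 lam mu) ∧
    -- the mean violation time between consecutive peaks
    (∀ k, Integrable (g k) P ∧ ∫ ω, g k ω ∂P = meanDurationDM11 lam mu d) ∧
    -- the long-run fraction of time with age above `d`, almost surely
    (∀ᵐ ω ∂P, Tendsto (fun T : ℝ => volume.real {t : ℝ | t ∈ Set.Icc 0 T ∧ d < Δ t ω} / T) atTop
      (𝓝 (nuDM11 lam mu * meanDurationDM11 lam mu d))) ∧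
    -- the limit of `P(Δ(t) > d)`, whenever it exists
    (∀ v : ℝ, Tendsto (fun t : ℝ => P.real {ω | d < Δ t ω}) atTop (𝓝 v) →
      v = nuDM11 lam mu * meanDurationDM11 lam mu d) ∧
    -- it does exist if the phase of the arrivals is stationary, i.e. uniform over a period
    (pdf.IsUniform φ (Set.Ico 0 (1 / lam)) P volume →
      Tendsto (fun t : ℝ => P.real {ω | d < Δ t ω}) atTop
        (𝓝 (nuDM11 lam mu * meanDurationDM11 lam mu d))) := by
  exact mainTheorem6_general P lam mu d a₀ hlam hmu (le_trans (by positivity) hd) ha₀ X hX hXlaw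
    hXindep φ hφ hφ0 hφX
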